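/- View permutations of $\{1,\dots,n\}$ as words $\pi=\pi_1\cdots\pi_n$, and let $\mathfrak S_n$ be the set of them. Define the stack sorting operator $S$ on words with distinct positive integer letters by $S(\emptyset)=\emptyset$ and $S(LmR)=S(L)\,S(R)\,m$, where $m$ is the greatest letter of the word $LmR$. A permutation $\pi\in\mathfrak S_n$ is $k$-stack sortable if $S^k(\pi)=12\cdots n$. In a pattern, let $*$ stand for any (possibly empty) word and $?$ for any single letter; the letters of a pattern are written side by side. Let $n\ge 6$. The $(n-4)$-stack sortable permutations in $\mathfrak S_n$ are exactly the permutations in $\mathfrak S_n$ that are of none of the following types: (A) $*\,n1$; (B) $*\,n2$, $\ *(n-1)1n$, $\ *\,n1?$, $\ *\,n?1$, $\ *\,n*(n-2)*(n-1)1$; (C) with $n$ in last position: $*(n-1)2n$, $\ *(n-1)?1n$, $\ *(n-1)1?n$, $\ *(n-1)*(n-3)*(n-2)1n$, $\ *(n-2)1(n-1)n$; with exactly one letter to the right of $n$: $*\,n3$, $\ *(n-1)1n?$, $\ *(n-2)1n(n-1)$; with exactly two letters to the right of $n$: $*\,n2?$, $\ *\,n?2$; with exactly three letters to the right of $n$: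 $*\,n??1$ but not $*\,n(n-2)(n-1)1$, $\ *\,n?1?$, $\ *\,n1??$, $\ *\,n(n-2)(n-1)2$; with more than three letters to the right of $n$: $*\,nA(n-2)B(n-1)2$ where $A,B$ are words that are not both empty, $\ *\,n*(n-3)*(n-1)(n-2)1$, $\ *\,n*(n-1)*(n-3)*(n-2)1$, $\ *(n-1)*n*(n-3)*(n-4)*(n-2)1$, $\ *(n-1)*n*(n-4)*(n-3)*(n-2)1$, $\ *\,n*(n-2)*(n-1)1?$, $\ *\,n*(n-2)*(n-1)?1$, $\ *\,n*(n-3)*(n-1)1(n-2)$, $\ *\,n*(n-3)*(n-2)1(n-1)$, $\ *(n-2)*n*(n-3)*(n-4)*(n-1)1$, $\ *(n-2)*n*(n-4)*(n-3)*(n-1)1$. The number of $(n-4)$-stack sortable permutations in $\mathfrak S_n$ is $$\frac{(n-4)!\,\bigl(3n^4-18n^3-4n^2+158n-192\bigr)}{3}.$$ -/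

import Mathlib

/-- The stack sorting operator on words. For a nonempty word with greatest letter `m`, written
as `L m R`, it is given by `S (L m R) = S L ++ S R ++ [m]`. -/
def stackSort (w : List ℕ) : List ℕ :=
  match h : w.max? with
  | none => []
  | some m =>
    stackSort (w.take (w.idxOf m)) ++ stackSort (w.drop (w.idxOf m + 1)) ++ [m]
termination_by w.length
decreasing_by
  all_goals
    have hm : m ∈ w := List.max?_mem h
    have hi : w.idxOf m < w.length := List.idxOf_lt_length_iff.mpr hm
    simp only [List.length_take, List.length_drop]
    omega

/-- The identity permutation `1 2 … n`, as a word. -/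
def idWord (n : ℕ) : List ℕ := List.range' 1 n

/-- The permutations of `{1, …, n}`, viewed as words: the rearrangements of `1 2 … n`. -/
def permWords (n : ℕ) : Set (List ℕ) := {w | w.Perm (idWord n)}

/-- The `k`-stack sortable permutations of `{1, …, n}`: those turned into the identity by
`k` passes of the stack sorting operator. -/
def stackSortable (n k : ℕ) : Set (List ℕ) :=
  {w | w ∈ permWords n ∧ stackSort^[k] w = idWord n}

/-- Symbols of glob patterns: an asterisk (any word, possibly empty), a question mark (any single
letter), or a given letter. -/
inductive GlobSymbol where
  | star : GlobSymbol
  | any : GlobSymbol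
  | lit (a : ℕ) : GlobSymbol

/-- The set of words of the form given by a glob pattern. -/
def glob : List GlobSymbol → Set (List ℕ)
  | [] => {[]}
  | .star :: p => {w | ∃ u v : List ℕ, v ∈ glob p ∧ w = u ++ v}
  | .any :: p => {w | ∃ (a : ℕ) (v : List ℕ), v ∈ glob p ∧ w = a :: v}
  | .lit a :: p => {w | ∃ v : List ℕ, v ∈ glob p ∧ w = a :: v}

/-- The set of words that have the form of at least one pattern of a list. -/
def globs (ps : List (List GlobSymbol)) : Set (List ℕ) := {w | ∃ p ∈ ps, w ∈ glob p}

/-- The type `* n 1` (permutations needing `n - 1` passes). -/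
def typesA (n : ℕ) : Set (List ℕ) := glob [.star, .lit n, .lit 1]

/-- The types `* n 2`, `* (n-1) 1 n`, `* n 1 ?`, `* n ? 1` and `* n * (n-2) * (n-1) 1`
(permutations needing `n - 2` passes). -/
def typesB (n : ℕ) : Set (List ℕ) :=
  globs [
    [.star, .lit n, .lit 2],
    [.star, .lit (n - 1), .lit 1, .lit n],
    [.star, .lit n, .lit 1, .any],
    [.star, .lit n, .any, .lit 1],
    [.star, .lit n, .star, .lit (n - 2), .star, .lit (n - 1), .lit 1]]

/-- The types of the table of permutations needing `n - 3` passes, grouped by the position of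
the letter `n` (which is forced by the pattern in each case). -/
def typesC (n : ℕ) : Set (List ℕ) :=
  -- `n` is the last letter
  globs [
    [.star, .lit (n - 1), .lit 2, .lit n],
    [.star, .lit (n - 1), .any, .lit 1, .lit n],
    [.star, .lit (n - 1), .lit 1, .any, .lit n],
    [.star, .lit (n - 1), .star, .lit (n - 3), .star, .lit (n - 2), .lit 1, .lit n],
    [.star, .lit (n - 2), .lit 1, .lit (n - 1), .lit n]] ∪
  -- one letter to the right of `n`
  globs [
    [.star, .lit n, .lit 3],
    [.star, .lit (n - 1), .lit 1, .lit n, .any],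
    [.star, .lit (n - 2), .lit 1, .lit n, .lit (n - 1)]] ∪
  -- two letters to the right of `n`
  globs [
    [.star, .lit n, .lit 2, .any],
    [.star, .lit n, .any, .lit 2]] ∪
  -- three letters to the right of `n`
  (glob [.star, .lit n, .any, .any, .lit 1] \
    glob [.star, .lit n, .lit (n - 2), .lit (n - 1), .lit 1]) ∪
  globs [
    [.star, .lit n, .any, .lit 1, .any],
    [.star, .lit n, .lit 1, .any, .any],
    [.star, .lit n, .lit (n - 2), .lit (n - 1), .lit 2]] ∪
  -- more than three letters to the right of `n`
  {w | ∃ u A B : List ℕ, (A ≠ [] ∨ B ≠ []) ∧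
    w = u ++ [n] ++ A ++ [n - 2] ++ B ++ [n - 1, 2]} ∪
  globs [
    [.star, .lit n, .star, .lit (n - 3), .star, .lit (n - 1), .lit (n - 2), .lit 1],
    [.star, .lit n, .star, .lit (n - 1), .star, .lit (n - 3), .star, .lit (n - 2), .lit 1],
    [.star, .lit (n - 1), .star, .lit n, .star, .lit (n - 3), .star, .lit (n - 4), .star,
      .lit (n - 2), .lit 1],
    [.star, .lit (n - 1), .star, .lit n, .star, .lit (n - 4), .star, .lit (n - 3), .star,
      .lit (n - 2), .lit 1],
    [.star, .lit n, .star, .lit (n - 2), .star, .lit (n - 1), .lit 1, .any],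
    [.star, .lit n, .star, .lit (n - 2), .star, .lit (n - 1), .any, .lit 1],
    [.star, .lit n, .star, .lit (n - 3), .star, .lit (n - 1), .lit 1, .lit (n - 2)],
    [.star, .lit n, .star, .lit (n - 3), .star, .lit (n - 2), .lit 1, .lit (n - 1)],
    [.star, .lit (n - 2), .star, .lit n, .star, .lit (n - 3), .star, .lit (n - 4), .star,
      .lit (n - 1), .lit 1],
    [.star, .lit (n - 2), .star, .lit n, .star, .lit (n - 4), .star, .lit (n - 3), .star,
      .lit (n - 1), .lit 1]]

/-!
A word is sorted exactly if none of its letters is preceded by a larger one, so it has to be found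
out, for each letter `a`, whether larger letters stand before it after `k` passes. Deleting the
letters below `a` does not disturb the stack sorting of the remaining ones (`stackSort_filter`), so
`a` may be taken to be the least letter. If `P` is the word before the least letter, one pass
replaces `P` by the word `emitted P` of the letters that leave the stack before the least letter
enters it (`stackSort_append_min`). Hence `S^k` sorts a permutation if and only if, for each letter
`a`, the word of the larger letters before `a` becomes empty after `k` emissions
(`stackSort_iterate_eq_idWord_iff`).

An emission drops exactly the right-to-left maxima, so it shortens a nonempty word. For `k = n - 4`
only the letters `1`, `2`, `3` have enough larger letters to cause trouble (`not_sorted_iff`), and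
the words of larger letters before them have length at most `k + 3`, `k + 2`, `k + 1`. A word of
length `k + 1` survives `k` emissions if and only if it ends with its greatest letter. Slightly
longer words may lose one or two letters more in the first emissions; following where these losses
can occur describes the survivors by the positions of their three, respectively five, greatest
letters (`emitted_iterate_ne_nil_iff₁`, `emitted_iterate_ne_nil_iff_survivalPositions`). The crucial
point is that the first emission of a word with two or three right-to-left maxima is a concatenation
of as many words returned by `S`, each of which ends with its greatest letter unless it is empty.

Being unsorted is thus a condition on the positions of `n, …, n - 4` and `1, 2, 3`; it is put into
the form of a list of mutually exclusive cases, `BadPositions` (`not_sorted_iff_badPositions`). The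
patterns translate into conditions on the same positions, and the two conditions agree
(`mem_types_iff_badPositions`).

For the number, each case prescribes the positions of `j` letters and possibly the relative order of
`m` others, which holds for `(n - j)! / m!` permutations (`countPositions_mul_factorial`), or it is
a difference of such conditions. The sum over the cases is subtracted from `n!`.
-/

/-! ### Stack sorting through the greatest letter -/

/-- The letters that leave the stack before the whole word has been read, in the order in which
they leave it. The letters still on the stack at that moment are the right-to-left maxima of the
word; so for a word `L m R` with greatest letter `m` this is `S L` followed by the letters emitted
from `R`. -/
def emitted (w : List ℕ) : List ℕ :=
  match h : w.max? with
  | none => []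
  | some m => stackSort (w.take (w.idxOf m)) ++ emitted (w.drop (w.idxOf m + 1))
termination_by w.length
decreasing_by
  have hm : m ∈ w := List.max?_mem h
  have hi : w.idxOf m < w.length := List.idxOf_lt_length_iff.mpr hm
  simp only [List.length_drop]
  omega

@[simp] lemma stackSort_nil : stackSort [] = [] := by
  rw [stackSort]; simp

@[simp] lemma emitted_nil : emitted [] = [] := by
  rw [emitted]; simp

lemma max?_append_cons {L R : List ℕ} {m : ℕ} (hL : ∀ x ∈ L, x < m) (hR : ∀ x ∈ R, x < m) :
    (L ++ m :: R).max? = some m := by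
  rw [List.max?_eq_some_iff]
  refine ⟨by simp, fun b hb => ?_⟩
  rcases List.mem_append.1 hb with h | h
  · exact (hL b h).le
  · rcases List.mem_cons.1 h with rfl | h
    · exact le_rfl
    · exact (hR b h).le

lemma idxOf_append_cons {L : List ℕ} (R : List ℕ) {m : ℕ} (hL : m ∉ L) :
    (L ++ m :: R).idxOf m = L.length := by
  rw [List.idxOf_append_of_notMem hL]; simp

lemma stackSort_append_cons {L R : List ℕ} {m : ℕ} (hL : ∀ x ∈ L, x < m) (hR : ∀ x ∈ R, x < m) :
    stackSort (L ++ m :: R) = stackSort L ++ stackSort R ++ [m] := by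
  have hi := idxOf_append_cons R (fun h => (hL m h).false)
  rw [stackSort]
  split
  · next h => rw [max?_append_cons hL hR] at h; cases h
  · next m' h =>
    rw [max?_append_cons hL hR] at h
    cases h
    simp [hi]

lemma emitted_append_cons {L R : List ℕ} {m : ℕ} (hL : ∀ x ∈ L, x < m) (hR : ∀ x ∈ R, x < m) :
    emitted (L ++ m :: R) = stackSort L ++ emitted R := by
  have hi := idxOf_append_cons R (fun h => (hL m h).false)
  rw [emitted]
  split
  · next h => rw [max?_append_cons hL hR] at h; cases h
  · next m' h =>
    rw [max?_append_cons hL hR] at h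
    cases h
    simp [hi]

/-- A word with distinct letters splits at its greatest letter. -/
lemma exists_max_split {w : List ℕ} (hw : w.Nodup) (h0 : w ≠ []) :
    ∃ L m R, w = L ++ m :: R ∧ (∀ x ∈ L, x < m) ∧ (∀ x ∈ R, x < m) := by
  obtain ⟨m, hm⟩ : ∃ m, w.max? = some m := by
    cases h : w.max? with
    | none => exact absurd (List.max?_eq_none_iff.1 h) h0
    | some m => exact ⟨m, rfl⟩
  obtain ⟨hmem, hle⟩ := List.max?_eq_some_iff.1 hm
  obtain ⟨L, R, rfl⟩ := List.append_of_mem hmem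
  have hn := List.nodup_middle.1 hw
  simp only [List.nodup_cons, List.mem_append, not_or] at hn
  refine ⟨L, m, R, rfl, fun x hx => ?_, fun x hx => ?_⟩
  · exact lt_of_le_of_ne (hle x (by simp [hx])) fun h => hn.1.1 (h ▸ hx)
  · exact lt_of_le_of_ne (hle x (by simp [hx])) fun h => hn.1.2 (h ▸ hx)

/-- Induction along the recursion that defines the stack sorting operator. -/
lemma maxSplit_induction {p : List ℕ → Prop} (nil : p [])
    (split : ∀ L m R, (∀ x ∈ L, x < m) → (∀ x ∈ R, x < m) → (L ++ m :: R).Nodup → L.Nodup →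
      R.Nodup → p L → p R → p (L ++ m :: R))
    {w : List ℕ} (hw : w.Nodup) : p w := by
  induction hl : w.length using Nat.strong_induction_on generalizing w with
  | _ l ih =>
    by_cases h0 : w = []
    · exact h0 ▸ nil
    · obtain ⟨L, m, R, rfl, hL, hR⟩ := exists_max_split hw h0
      have hLn : L.Nodup := hw.sublist (List.sublist_append_left _ _)
      have hRn : R.Nodup :=
        hw.sublist ((List.sublist_cons_self m R).trans (List.sublist_append_right _ _))
      simp only [List.length_append, List.length_cons] at hl
      exact split L m R hL hR hw hLn hRn (ih _ (by omega) hLn rfl) (ih _ (by omega) hRn rfl)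

lemma stackSort_perm {w : List ℕ} (hw : w.Nodup) : (stackSort w).Perm w := by
  refine maxSplit_induction (p := fun w => (stackSort w).Perm w) (by simp) ?_ hw
  intro L m R hL hR _ _ _ ihL ihR
  rw [stackSort_append_cons hL hR, List.append_assoc]
  exact ihL.append ((List.perm_append_singleton _ _).trans (ihR.cons m))

lemma stackSort_nodup {w : List ℕ} (hw : w.Nodup) : (stackSort w).Nodup :=
  (stackSort_perm hw).nodup_iff.2 hw

lemma length_stackSort {w : List ℕ} (hw : w.Nodup) : (stackSort w).length = w.length :=
  (stackSort_perm hw).length_eq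

lemma mem_stackSort {w : List ℕ} (hw : w.Nodup) {x : ℕ} : x ∈ stackSort w ↔ x ∈ w :=
  (stackSort_perm hw).mem_iff

lemma stackSort_iterate_perm {w : List ℕ} (hw : w.Nodup) (k : ℕ) :
    (stackSort^[k] w).Perm w := by
  induction k generalizing w with
  | zero => exact List.Perm.refl w
  | succ k ih =>
    rw [Function.iterate_succ_apply]
    exact (ih (stackSort_nodup hw)).trans (stackSort_perm hw)

lemma emitted_subperm {w : List ℕ} (hw : w.Nodup) : (emitted w).Subperm w := by
  refine maxSplit_induction (p := fun w => (emitted w).Subperm w) (by simp) ?_ hw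
  intro L m R hL hR _ hLn _ _ ihR
  rw [emitted_append_cons hL hR]
  exact (stackSort_perm hLn).subperm.append (ihR.trans (List.sublist_cons_self m R).subperm)

lemma emitted_nodup {w : List ℕ} (hw : w.Nodup) : (emitted w).Nodup := by
  obtain ⟨l, hl, hs⟩ := emitted_subperm hw
  exact hl.nodup_iff.1 (hw.sublist hs)

/-- The order in which letters `≥ a` leave the stack is not affected by the letters below `a`. -/
lemma stackSort_filter {w : List ℕ} (hw : w.Nodup) (a : ℕ) :
    stackSort (w.filter (a ≤ ·)) = (stackSort w).filter (a ≤ ·) := by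
  refine maxSplit_induction
    (p := fun w => stackSort (w.filter (a ≤ ·)) = (stackSort w).filter (a ≤ ·)) (by simp) ?_ hw
  intro L m R hL hR _ hLn hRn ihL ihR
  by_cases ham : a ≤ m
  · rw [stackSort_append_cons hL hR, List.filter_append, List.filter_cons_of_pos (by simpa),
      stackSort_append_cons, ihL, ihR]
    · simp [ham]
    · exact fun x hx => hL x (List.mem_of_mem_filter hx)
    · exact fun x hx => hR x (List.mem_of_mem_filter hx)
  · have h1 : ∀ x ∈ L ++ m :: R, ¬ a ≤ x := by
      intro x hx
      simp only [List.mem_append, List.mem_cons] at hx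
      rcases hx with h | rfl | h
      · have := hL x h; omega
      · exact ham
      · have := hR x h; omega
    have h2 : ∀ x ∈ stackSort (L ++ m :: R), ¬ a ≤ x := fun x hx =>
      h1 x ((mem_stackSort ‹_›).1 hx)
    rw [List.filter_eq_nil_iff.2 (by simpa using h1), List.filter_eq_nil_iff.2 (by simpa using h2),
      stackSort_nil]

lemma stackSort_iterate_filter {w : List ℕ} (hw : w.Nodup) (a k : ℕ) :
    stackSort^[k] (w.filter (a ≤ ·)) = (stackSort^[k] w).filter (a ≤ ·) := by
  induction k generalizing w with
  | zero => rfl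
  | succ k ih =>
    rw [Function.iterate_succ_apply, Function.iterate_succ_apply, stackSort_filter hw,
      ih (stackSort_nodup hw)]

/-- When the least letter `a` enters the stack, exactly the emitted letters of the prefix before
it have left, and `a` leaves next. -/
lemma stackSort_append_min {P R : List ℕ} {a : ℕ} (hw : (P ++ a :: R).Nodup)
    (hP : ∀ x ∈ P, a < x) (hR : ∀ x ∈ R, a < x) :
    ∃ Z, stackSort (P ++ a :: R) = emitted P ++ a :: Z := by
  induction hl : P.length + R.length using Nat.strong_induction_on generalizing P R with
  | _ l ih =>
    obtain ⟨L, m, R', h, hL, hR'⟩ := exists_max_split hw (by simp)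
    rw [h, stackSort_append_cons hL hR']
    have hw' := hw
    rw [h] at hw'
    rcases List.append_eq_append_iff.1 h with ⟨A, hA, hB⟩ | ⟨A, hA, hB⟩
    · cases A with
      | nil =>
        simp only [List.nil_append, List.cons.injEq] at hB
        obtain ⟨rfl, rfl⟩ := hB
        have hPn : P = [] := by
          cases P with
          | nil => rfl
          | cons x P =>
            have h1 := hP x (by simp)
            have h2 := hL x (by simp [hA])
            omega
        subst hPn
        have hRn : R = [] := by
          cases R with
          | nil => rfl
          | cons x R =>
            have h1 := hR x (by simp)
            have h2 := hR' x (by simp)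
            omega
        subst hRn
        simp at hA
        subst hA
        exact ⟨[], by simp⟩
      | cons b A =>
        simp only [List.cons_append, List.cons.injEq] at hB
        obtain ⟨rfl, rfl⟩ := hB
        subst hA
        obtain ⟨Z, hZ⟩ := ih (P.length + A.length) (by simp at hl; omega) (P := P) (R := A)
          (hw'.sublist (List.sublist_append_left _ _)) hP (fun x hx => hR x (by simp [hx])) rfl
        exact ⟨Z ++ stackSort R' ++ [m], by simp [hZ]⟩
    · cases A with
      | nil =>
        simp only [List.nil_append, List.cons.injEq] at hB
        obtain ⟨rfl, rfl⟩ := hB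
        simp only [List.append_nil] at hA
        subst hA
        have hPn : P = [] := by
          cases P with
          | nil => rfl
          | cons x P =>
            have h1 := hP x (by simp)
            have h2 := hL x (by simp)
            omega
        subst hPn
        have hRn : R' = [] := by
          cases R' with
          | nil => rfl
          | cons x R =>
            have h1 := hR x (by simp)
            have h2 := hR' x (by simp)
            omega
        subst hRn
        exact ⟨[], by simp⟩
      | cons b A =>
        simp only [List.cons_append, List.cons.injEq] at hB
        obtain ⟨rfl, rfl⟩ := hB
        subst hA
        obtain ⟨Z, hZ⟩ := ih (A.length + R.length) (by simp at hl; omega) (P := A) (R := R)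
          (hw'.sublist ((List.sublist_cons_self _ _).trans (List.sublist_append_right _ _)))
          (fun x hx => hP x (by simp [hx])) hR rfl
        refine ⟨Z ++ [m], ?_⟩
        rw [emitted_append_cons hL (fun x hx => hR' x (by simp [hx])), hZ]
        simp

lemma stackSort_iterate_append_min {P R : List ℕ} {a : ℕ} (hw : (P ++ a :: R).Nodup)
    (hP : ∀ x ∈ P, a < x) (hR : ∀ x ∈ R, a < x) (k : ℕ) :
    ∃ Z, stackSort^[k] (P ++ a :: R) = emitted^[k] P ++ a :: Z := by
  induction k generalizing P R with
  | zero => exact ⟨R, rfl⟩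
  | succ k ih =>
    obtain ⟨Z, hZ⟩ := stackSort_append_min hw hP hR
    rw [Function.iterate_succ_apply, Function.iterate_succ_apply, hZ]
    have hn := stackSort_nodup hw
    have hmem : ∀ x ∈ emitted P ++ a :: Z, x ≠ a → a < x := by
      intro x hx hxa
      rw [← hZ, mem_stackSort hw] at hx
      simp only [List.mem_append, List.mem_cons] at hx
      rcases hx with h | h | h
      · exact hP x h
      · exact absurd h hxa
      · exact hR x h
    rw [hZ] at hn
    have hn' := List.nodup_middle.1 hn
    simp only [List.nodup_cons, List.mem_append, not_or] at hn'
    exact ih hn (fun x hx => hmem x (by simp [hx]) fun h => hn'.1.1 (h ▸ hx))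
      (fun x hx => hmem x (by simp [hx]) fun h => hn'.1.2 (h ▸ hx))

/-- The word of the letters `> a` that stand before `a`. -/
def largerBefore (a : ℕ) (w : List ℕ) : List ℕ :=
  (w.filter (a ≤ ·)).take ((w.filter (a ≤ ·)).idxOf a)

lemma eq_take_append_cons {w : List ℕ} {a : ℕ} (ha : a ∈ w) :
    w = w.take (w.idxOf a) ++ a :: w.drop (w.idxOf a + 1) := by
  have h := List.idxOf_lt_length_iff.2 ha
  conv_lhs => rw [← List.take_append_drop (w.idxOf a) w, List.drop_eq_getElem_cons h]
  simp

lemma filter_eq_largerBefore {w : List ℕ} (hw : w.Nodup) {a : ℕ} (ha : a ∈ w) :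
    ∃ R, w.filter (a ≤ ·) = largerBefore a w ++ a :: R ∧
      (∀ x ∈ largerBefore a w, a < x) ∧ ∀ x ∈ R, a < x := by
  have h := eq_take_append_cons (w := w.filter (a ≤ ·)) (a := a) (by simp [ha])
  refine ⟨_, h, ?_⟩
  have hn := hw.filter (a ≤ ·)
  have hle : ∀ x ∈ w.filter (a ≤ ·), a ≤ x := by simp
  rw [h] at hn
  have hn' := List.nodup_middle.1 hn
  simp only [List.nodup_cons, List.mem_append, not_or] at hn'
  constructor
  · exact fun x hx => lt_of_le_of_ne (hle x (List.mem_of_mem_take hx)) fun e => hn'.1.1 (e ▸ hx)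
  · exact fun x hx => lt_of_le_of_ne (hle x (List.mem_of_mem_drop hx)) fun e => hn'.1.2 (e ▸ hx)

lemma idWord_sortedLT (n : ℕ) : (idWord n).Pairwise (· < ·) := List.pairwise_lt_range'

lemma idWord_nodup (n : ℕ) : (idWord n).Nodup := List.nodup_range'

/-- A permutation is sorted by `k` passes if and only if, for each letter `a`, the word of the
larger letters before `a` is exhausted by emitting `k` times. -/
lemma stackSort_iterate_eq_idWord_iff {n k : ℕ} {w : List ℕ} (hw : w.Perm (idWord n)) :
    stackSort^[k] w = idWord n ↔ ∀ a ∈ w, emitted^[k] (largerBefore a w) = [] := by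
  have hn : w.Nodup := hw.nodup_iff.2 (idWord_nodup n)
  have key : ∀ a ∈ w, ∃ Z, (stackSort^[k] w).filter (a ≤ ·) =
      emitted^[k] (largerBefore a w) ++ a :: Z := by
    intro a ha
    obtain ⟨R, hR, h1, h2⟩ := filter_eq_largerBefore hn ha
    rw [← stackSort_iterate_filter hn, hR]
    exact stackSort_iterate_append_min (hR ▸ hn.filter _) h1 h2 k
  have hperm := stackSort_iterate_perm hn k
  have hnk : (stackSort^[k] w).Nodup := hperm.nodup_iff.2 hn
  constructor
  · intro h a ha
    obtain ⟨Z, hZ⟩ := key a ha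
    have hs : ((stackSort^[k] w).filter (a ≤ ·)).Pairwise (· < ·) := by
      rw [h]; exact (idWord_sortedLT n).filter _
    have hle : ∀ x ∈ (stackSort^[k] w).filter (a ≤ ·), a ≤ x := by simp
    rw [hZ] at hs hle
    rw [List.eq_nil_iff_forall_not_mem]
    intro x hx
    have h1 := (List.pairwise_append.1 hs).2.2 x hx a (by simp)
    have h2 := hle x (by simp [hx])
    omega
  · intro h
    refine List.Perm.eq_of_pairwise' ?_ (idWord_sortedLT n) (hperm.trans hw)
    rw [List.pairwise_iff_forall_sublist]
    intro b a hs
    by_contra hba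
    have ha : a ∈ w := hperm.mem_iff.1 (hs.subset (by simp))
    have hne : b ≠ a := by
      have := hnk.sublist hs
      simpa using this
    obtain ⟨Z, hZ⟩ := key a ha
    have hf := hs.filter (a ≤ ·)
    rw [hZ, h a ha] at hf
    have hnf := hnk.filter (a ≤ ·)
    rw [hZ, h a ha] at hnf
    have e : [b, a].filter (a ≤ ·) = [b, a] := by
      have : a ≤ b := by omega
      simp [this]
    rw [e, List.nil_append, List.cons_sublist_cons'] at hf
    rcases hf with hf | hf
    · have := hf.subset (show a ∈ [b, a] by simp)
      simp_all
    · exact hne hf.1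

/-! ### Words that survive many emissions -/

/-- The last letter of the word is its greatest letter. -/
def EndsMax (w : List ℕ) : Prop := ∃ L m, w = L ++ [m] ∧ ∀ x ∈ L, x < m

lemma exists_stackSort_eq_append {w : List ℕ} (hw : w.Nodup) (h0 : w ≠ []) :
    ∃ Z m, stackSort w = Z ++ [m] ∧ ∀ x ∈ Z, x < m := by
  obtain ⟨L, m, R, rfl, hL, hR⟩ := exists_max_split hw h0
  refine ⟨_, m, stackSort_append_cons hL hR, fun x hx => ?_⟩
  have hx' : x ∈ stackSort (L ++ m :: R) := by
    rw [stackSort_append_cons hL hR]; exact List.mem_append_left _ hx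
  have hn := stackSort_nodup hw
  rw [stackSort_append_cons hL hR] at hn
  have hxm : x ≠ m := fun e => by
    have := List.disjoint_of_nodup_append hn hx
    simp [e] at this
  rw [mem_stackSort hw] at hx'
  simp only [List.mem_append, List.mem_cons] at hx'
  rcases hx' with h | h | h
  · exact hL x h
  · exact absurd h hxm
  · exact hR x h

lemma endsMax_stackSort {w : List ℕ} (hw : w.Nodup) (h0 : w ≠ []) : EndsMax (stackSort w) := by
  obtain ⟨Z, m, h, hZ⟩ := exists_stackSort_eq_append hw h0
  exact ⟨Z, m, h, hZ⟩

lemma emitted_of_endsMax {L : List ℕ} {m : ℕ} (hL : ∀ x ∈ L, x < m) :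
    emitted (L ++ [m]) = stackSort L := by
  rw [emitted_append_cons hL (by simp)]; simp

lemma length_emitted_lt {w : List ℕ} (hw : w.Nodup) (h0 : w ≠ []) :
    (emitted w).length < w.length := by
  obtain ⟨L, m, R, rfl, hL, hR⟩ := exists_max_split hw h0
  have hLn : L.Nodup := hw.sublist (List.sublist_append_left _ _)
  have hRn : R.Nodup :=
    hw.sublist ((List.sublist_cons_self m R).trans (List.sublist_append_right _ _))
  have := (emitted_subperm hRn).length_le
  rw [emitted_append_cons hL hR]
  simp only [List.length_append, List.length_cons, length_stackSort hLn]
  omega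

lemma length_emitted_iterate_le {w : List ℕ} (hw : w.Nodup) (k : ℕ) :
    (emitted^[k] w).length ≤ w.length - k := by
  induction k generalizing w with
  | zero => simp
  | succ k ih =>
    rw [Function.iterate_succ_apply]
    by_cases h0 : w = []
    · subst h0
      simpa using ih (w := []) (by simp)
    · have h1 := length_emitted_lt hw h0
      have h2 := ih (emitted_nodup hw)
      omega

lemma emitted_iterate_eq_nil {w : List ℕ} (hw : w.Nodup) {k : ℕ} (hk : w.length ≤ k) :
    emitted^[k] w = [] := by
  have := length_emitted_iterate_le hw k
  exact List.length_eq_zero_iff.1 (by omega)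

/-- If the greatest letter comes last, every emission removes one letter only, since the words
that the stack sorting operator returns end with their greatest letter again. -/
lemma emitted_iterate_ne_nil_of_endsMax {w : List ℕ} (hw : w.Nodup) (h : EndsMax w) {k : ℕ}
    (hk : k < w.length) : emitted^[k] w ≠ [] := by
  induction k generalizing w with
  | zero => exact List.ne_nil_of_length_pos hk
  | succ k ih =>
    obtain ⟨L, m, rfl, hL⟩ := h
    have hLn : L.Nodup := hw.sublist (List.sublist_append_left _ _)
    simp only [List.length_append, List.length_cons, List.length_nil] at hk
    rw [Function.iterate_succ_apply, emitted_of_endsMax hL]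
    refine ih (stackSort_nodup hLn) (endsMax_stackSort hLn ?_) ?_
    · rintro rfl; simp at hk
    · rw [length_stackSort hLn]; omega

/-- A word of length `k + 1` survives `k` emissions only if none of them removes more than one
letter. -/
lemma emitted_iterate_ne_nil_iff_endsMax {w : List ℕ} (hw : w.Nodup) {k : ℕ}
    (hk : w.length = k + 1) : emitted^[k] w ≠ [] ↔ EndsMax w := by
  refine ⟨fun h => ?_, fun h => emitted_iterate_ne_nil_of_endsMax hw h (by omega)⟩
  obtain ⟨L, m, R, rfl, hL, hR⟩ := exists_max_split hw (List.ne_nil_of_length_pos (by omega))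
  by_cases hR0 : R = []
  · subst hR0; exact ⟨L, m, rfl, hL⟩
  · exfalso
    have hLn : L.Nodup := hw.sublist (List.sublist_append_left _ _)
    have hRn : R.Nodup :=
      hw.sublist ((List.sublist_cons_self m R).trans (List.sublist_append_right _ _))
    have h1 := length_emitted_lt hRn hR0
    simp only [List.length_append, List.length_cons] at hk
    obtain ⟨j, rfl⟩ : ∃ j, k = j + 1 := ⟨k - 1, by omega⟩
    rw [Function.iterate_succ_apply] at h
    have hlen : (emitted (L ++ m :: R)).length ≤ j := by
      rw [emitted_append_cons hL hR, List.length_append, length_stackSort hLn]; omega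
    exact h (emitted_iterate_eq_nil (emitted_nodup hw) hlen)

lemma endsMax_iff_getLast? {w : List ℕ} (hw : w.Nodup) {u : ℕ} (hu : u ∈ w)
    (hmax : ∀ x ∈ w, x ≤ u) : EndsMax w ↔ w.getLast? = some u := by
  constructor
  · rintro ⟨L, m, rfl, hL⟩
    have h1 := hmax m (by simp)
    rcases List.mem_append.1 hu with h | h
    · have := hL u h; omega
    · simp_all
  · intro h
    obtain ⟨L, rfl⟩ := List.getLast?_eq_some_iff.1 h
    refine ⟨L, u, rfl, fun x hx => lt_of_le_of_ne (hmax x (by simp [hx])) ?_⟩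
    rintro rfl
    have := List.disjoint_of_nodup_append hw hx
    simp at this

lemma getLast?_stackSort {w : List ℕ} (hw : w.Nodup) : (stackSort w).getLast? = w.max? := by
  by_cases h0 : w = []
  · simp [h0]
  · obtain ⟨L, m, R, rfl, hL, hR⟩ := exists_max_split hw h0
    rw [max?_append_cons hL hR, stackSort_append_cons hL hR]
    simp

lemma max?_eq_some_iff_mem {w : List ℕ} {u : ℕ} (hmax : ∀ x ∈ w, x ≤ u) :
    w.max? = some u ↔ u ∈ w := by
  rw [List.max?_eq_some_iff]
  exact ⟨fun h => h.1, fun h => ⟨h, hmax⟩⟩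

lemma endsMax_stackSort_append {A B : List ℕ} (hn : (A ++ B).Nodup) {u : ℕ} (hu : u ∈ A ++ B)
    (hmax : ∀ x ∈ A ++ B, x ≤ u) : EndsMax (stackSort A ++ stackSort B) ↔ B = [] ∨ u ∈ B := by
  have hA := hn.sublist (List.sublist_append_left _ _)
  have hB := hn.sublist (List.sublist_append_right _ _)
  have hp : (stackSort A ++ stackSort B).Perm (A ++ B) :=
    (stackSort_perm hA).append (stackSort_perm hB)
  rw [endsMax_iff_getLast? (hp.nodup_iff.2 hn) (hp.mem_iff.2 hu)
    (fun x hx => hmax x (hp.mem_iff.1 hx)), List.getLast?_append, getLast?_stackSort hA,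
    getLast?_stackSort hB]
  by_cases h0 : B = []
  · subst h0
    simp only [List.append_nil] at hu hmax
    simpa using (max?_eq_some_iff_mem hmax).2 hu
  · obtain ⟨b, hb⟩ : ∃ b, B.max? = some b := by
      cases h : B.max? with
      | none => exact absurd (List.max?_eq_none_iff.1 h) h0
      | some m => exact ⟨m, rfl⟩
    rw [hb, Option.some_or, ← hb, max?_eq_some_iff_mem fun x hx => hmax x (by simp [hx])]
    simp [h0]

lemma endsMax_stackSort_append₃ {A B C : List ℕ} (hn : (A ++ B ++ C).Nodup) {u : ℕ}
    (hu : u ∈ A ++ B ++ C) (hmax : ∀ x ∈ A ++ B ++ C, x ≤ u) :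
    EndsMax (stackSort A ++ stackSort B ++ stackSort C) ↔
      u ∈ C ∨ (C = [] ∧ (B = [] ∨ u ∈ B)) := by
  by_cases h0 : C = []
  · subst h0
    simp only [List.append_nil] at hn hu hmax
    simpa using endsMax_stackSort_append hn hu hmax
  · have hAB := hn.sublist (List.sublist_append_left _ _)
    have hA := hAB.sublist (List.sublist_append_left _ _)
    have hB := hAB.sublist (List.sublist_append_right _ _)
    have hC := hn.sublist (List.sublist_append_right _ _)
    have hp : (stackSort A ++ stackSort B ++ stackSort C).Perm (A ++ B ++ C) :=
      ((stackSort_perm hA).append (stackSort_perm hB)).append (stackSort_perm hC)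
    rw [endsMax_iff_getLast? (hp.nodup_iff.2 hn) (hp.mem_iff.2 hu)
      (fun x hx => hmax x (hp.mem_iff.1 hx)), List.getLast?_append, getLast?_stackSort hC]
    obtain ⟨b, hb⟩ : ∃ b, C.max? = some b := by
      cases h : C.max? with
      | none => exact absurd (List.max?_eq_none_iff.1 h) h0
      | some m => exact ⟨m, rfl⟩
    rw [hb, Option.some_or, ← hb, max?_eq_some_iff_mem fun x hx => hmax x (by simp [hx])]
    simp [h0]

lemma exists_isMax {w : List ℕ} (h0 : w ≠ []) : ∃ u ∈ w, ∀ x ∈ w, x ≤ u := by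
  cases h : w.max? with
  | none => exact absurd (List.max?_eq_none_iff.1 h) h0
  | some m =>
    obtain ⟨h1, h2⟩ := List.max?_eq_some_iff.1 h
    exact ⟨m, h1, h2⟩

lemma idxOf_append_cons_self {L R : List ℕ} {m : ℕ} (hn : (L ++ m :: R).Nodup) :
    (L ++ m :: R).idxOf m = L.length :=
  idxOf_append_cons R fun h => by
    have := List.disjoint_of_nodup_append hn h
    simp at this

lemma mem_left_iff_idxOf_lt {L R : List ℕ} {m x : ℕ} :
    x ∈ L ↔ (L ++ m :: R).idxOf x < L.length := by
  by_cases hx : x ∈ L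
  · simp [hx, List.idxOf_append_of_mem, List.idxOf_lt_length_iff]
  · simp [hx, List.idxOf_append_of_notMem]

lemma mem_right_iff_lt_idxOf {L R : List ℕ} {m x : ℕ} (hn : (L ++ m :: R).Nodup)
    (hx : x ∈ L ++ m :: R) : x ∈ R ↔ L.length < (L ++ m :: R).idxOf x := by
  have h1 := List.nodup_middle.1 hn
  simp only [List.nodup_cons, List.mem_append, not_or] at h1
  by_cases hL : x ∈ L
  · have h2 := (mem_left_iff_idxOf_lt (m := m) (R := R)).1 hL
    have h3 : x ∉ R := fun h => List.disjoint_of_nodup_append hn hL (by simp [h])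
    simp only [h3, false_iff]; omega
  · rw [List.idxOf_append_of_notMem hL]
    by_cases hm : x = m
    · subst hm; simp [h1.1.2]
    · have : x ∈ R := by simpa [hL, hm] using hx
      simp [this, List.idxOf_cons_ne _ (Ne.symm hm)]

/-- The part of a split word that a letter belongs to, read off from the position of the letter. -/
lemma split_iff_idxOf {L R w : List ℕ} {m x : ℕ} (hw : w = L ++ m :: R) (hn : w.Nodup)
    (hx : x ∈ w) : (x ∈ L ↔ w.idxOf x < L.length) ∧ (x = m ↔ w.idxOf x = L.length) ∧
      (x ∈ R ↔ L.length < w.idxOf x) := by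
  subst hw
  refine ⟨mem_left_iff_idxOf_lt, ?_, mem_right_iff_lt_idxOf hn hx⟩
  constructor
  · rintro rfl; exact idxOf_append_cons_self hn
  · intro h
    rw [← idxOf_append_cons_self hn] at h
    exact (List.idxOf_inj hx).1 h

/-- A word with at least two right-to-left maxima `m` and `m'` loses these two in an emission. -/
lemma length_emitted_append_cons_append_cons {L L' R' : List ℕ} {m m' : ℕ}
    (hn : (L ++ m :: (L' ++ m' :: R')).Nodup)
    (hL : ∀ x ∈ L, x < m) (hR : ∀ x ∈ L' ++ m' :: R', x < m)
    (hL' : ∀ x ∈ L', x < m') (hR' : ∀ x ∈ R', x < m') :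
    (emitted (L ++ m :: (L' ++ m' :: R'))).length = L.length + L'.length + (emitted R').length := by
  simp only [List.nodup_append, List.nodup_cons] at hn
  rw [emitted_append_cons hL hR, emitted_append_cons hL' hR', List.length_append,
    List.length_append, length_stackSort hn.1, length_stackSort hn.2.1.2.1]
  omega

/-- A word of length `k + 2` survives `k` emissions only if the first one removes at most two
letters, and if it removes two, then the remaining word has to end with its greatest letter. -/
lemma emitted_iterate_ne_nil_iff_of_length_eq_add_two {L R : List ℕ} {m k : ℕ}
    (hn : (L ++ m :: R).Nodup) (hk : 1 ≤ k) (hlen : (L ++ m :: R).length = k + 2)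
    (hL : ∀ x ∈ L, x < m) (hR : ∀ x ∈ R, x < m) :
    emitted^[k] (L ++ m :: R) ≠ [] ↔ R = [] ∨ ∃ L' m', R = L' ++ [m'] ∧ (∀ x ∈ L', x < m') ∧
      (L' = [] ∨ ∀ u ∈ L ++ L', (∀ x ∈ L ++ L', x ≤ u) → u ∈ L') := by
  obtain ⟨j, rfl⟩ : ∃ j, k = j + 1 := ⟨k - 1, by omega⟩
  by_cases hR0 : R = []
  · subst hR0
    simpa using emitted_iterate_ne_nil_of_endsMax (k := j + 1) hn ⟨L, m, rfl, hL⟩ (by omega)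
  have hn' := hn
  simp only [List.nodup_append, List.nodup_cons] at hn'
  obtain ⟨L', m', R', rfl, hL', hR'⟩ := exists_max_split hn'.2.1.2 hR0
  have hem := length_emitted_append_cons_append_cons hn hL hR hL' hR'
  simp only [List.length_append, List.length_cons] at hlen
  simp only [List.nodup_append, List.nodup_cons] at hn'
  rw [Function.iterate_succ_apply]
  by_cases hR'0 : R' = []
  · subst hR'0
    have hnLL : (L ++ L').Nodup := by
      refine hn.sublist (List.Sublist.append (List.Sublist.refl L) ?_)
      exact (List.sublist_append_left _ _).trans (List.sublist_cons_self _ _)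
    obtain ⟨u, hu, hmax⟩ : ∃ u ∈ L ++ L', ∀ x ∈ L ++ L', x ≤ u :=
      exists_isMax (List.ne_nil_of_length_pos (by simp at hlen ⊢; omega))
    rw [emitted_iterate_ne_nil_iff_endsMax (emitted_nodup hn) (by simp at hem hlen; omega),
      emitted_append_cons hL hR, emitted_of_endsMax hL', endsMax_stackSort_append hnLL hu hmax]
    constructor
    · rintro (h | h)
      · exact Or.inr ⟨L', m', rfl, hL', Or.inl h⟩
      · refine Or.inr ⟨L', m', rfl, hL', Or.inr fun v hv hvm => ?_⟩
        rwa [le_antisymm (hmax v hv) (hvm u hu)]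
    · rintro (h | ⟨L'', m'', h, -, h2⟩)
      · simp at h
      · obtain ⟨rfl, h⟩ := List.append_inj' h rfl
        rcases h2 with h2 | h2
        · exact Or.inl h2
        · exact Or.inr (h2 u hu hmax)
  · have h1 := length_emitted_lt hn'.2.1.2.2.1.2 hR'0
    have h2 := emitted_iterate_eq_nil (emitted_nodup hn) (k := j) (by omega)
    simp only [h2, ne_eq, not_true, false_iff, not_or]
    refine ⟨by simp, ?_⟩
    rintro ⟨L'', m'', h, h3, -⟩
    -- the greatest letter `m'` of the right part is not its last letter
    rcases List.eq_nil_or_concat' R' with h4 | ⟨R'', b, rfl⟩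
    · exact hR'0 h4
    · rw [show L' ++ m' :: (R'' ++ [b]) = (L' ++ m' :: R'') ++ [b] by simp] at h
      obtain ⟨h5, h6⟩ := List.append_inj' h rfl
      have h7 := h3 m' (by simp [← h5])
      have h8 := hR' b (by simp)
      simp at h6
      omega

/-- For disjoint finite sets `A` and `B` below `m'`, whose union with `m'` has greatest elements
`t₂ > t₃`: the set `B` is nonempty, bounded by `m'` and contains the maximum of `A ∪ B` if and only
if `m' = t₂` and `t₃ ∈ B`. -/
lemma max_mem_iff_of_top {A B : ℕ → Prop} {m' t₂ t₃ : ℕ} (hAB : ∀ x, A x → ¬ B x)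
    (hA : ¬ A m') (hB : ¬ B m') (h₂ : A t₂ ∨ B t₂ ∨ t₂ = m') (h₃ : A t₃ ∨ B t₃ ∨ t₃ = m')
    (h₂₃ : t₃ < t₂) (htop : ∀ x, A x ∨ B x ∨ x = m' → x = t₂ ∨ x ≤ t₃) :
    ((∀ x, B x → x < m') ∧ (∃ x, B x) ∧
      ∀ u, A u ∨ B u → (∀ x, A x ∨ B x → x ≤ u) → B u) ↔ t₂ = m' ∧ B t₃ := by
  constructor
  · rintro ⟨h1, ⟨y, hy⟩, h⟩
    have ht₂ : t₂ = m' := by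
      rcases h₂ with h₂ | h₂ | h₂
      · refine absurd (h t₂ (Or.inl h₂) fun x hx => ?_) (hAB _ h₂)
        rcases htop x (by tauto) with h | h <;> omega
      · have h3 := h1 _ h₂
        rcases htop m' (by tauto) with h | h <;> omega
      · exact h₂
    subst ht₂
    refine ⟨rfl, h t₃ ?_ fun x hx => ?_⟩
    · rcases h₃ with h₃ | h₃ | h₃
      · exact Or.inl h₃
      · exact Or.inr h₃
      · omega
    · rcases htop x (by tauto) with rfl | h4
      · tauto
      · exact h4
  · rintro ⟨rfl, h⟩
    refine ⟨fun x hx => ?_, ⟨t₃, h⟩, fun u hu hum => ?_⟩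
    · rcases htop x (by tauto) with rfl | h4
      · tauto
      · omega
    · have h5 := hum t₃ (Or.inr h)
      rcases htop u (by tauto) with rfl | h4
      · tauto
      · rwa [le_antisymm h4 h5]

/-- Words of length `k + 2` that survive `k` emissions, in terms of the positions of their three
greatest letters `t₁ > t₂ > t₃`: they have the form `* t₁`, `* t₁ ?` or `* t₁ * t₃ * t₂`. -/
lemma emitted_iterate_ne_nil_iff₁ {Q : List ℕ} {k t₁ t₂ t₃ : ℕ} (hn : Q.Nodup) (hk : 1 ≤ k)
    (hlen : Q.length = k + 2) (h₁ : t₁ ∈ Q) (h₂ : t₂ ∈ Q) (h₃ : t₃ ∈ Q) (h₁₂ : t₂ < t₁)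
    (h₂₃ : t₃ < t₂) (htop : ∀ x ∈ Q, x = t₁ ∨ x = t₂ ∨ x ≤ t₃) :
    emitted^[k] Q ≠ [] ↔ Q.idxOf t₁ = k + 1 ∨ Q.idxOf t₁ = k ∨
      (Q.idxOf t₂ = k + 1 ∧ Q.idxOf t₁ < Q.idxOf t₃) := by
  obtain ⟨L, R, rfl⟩ := List.append_of_mem h₁
  have hn1 := List.nodup_cons.1 (List.nodup_middle.1 hn)
  have hne : ∀ x ∈ L ++ R, x < t₁ := by
    intro x hx
    have h2 : x ≠ t₁ := by
      rintro rfl; exact hn1.1 hx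
    rcases htop x (by simp at hx ⊢; tauto) with h | h | h <;> omega
  have hL : ∀ x ∈ L, x < t₁ := fun x hx => hne x (by simp [hx])
  have hR : ∀ x ∈ R, x < t₁ := fun x hx => hne x (by simp [hx])
  have hi := idxOf_append_cons_self hn
  rw [emitted_iterate_ne_nil_iff_of_length_eq_add_two hn hk hlen hL hR, hi]
  have hlen' := hlen
  simp only [List.length_append, List.length_cons] at hlen'
  have key : ∀ L' m', R = L' ++ [m'] → ((∀ x ∈ L', x < m') ∧ (∃ x, x ∈ L') ∧
      (∀ u ∈ L ++ L', (∀ x ∈ L ++ L', x ≤ u) → u ∈ L') ↔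
      (L ++ t₁ :: R).idxOf t₂ = k + 1 ∧ L.length < (L ++ t₁ :: R).idxOf t₃) := by
    rintro L' m' rfl
    have e : (L ++ t₁ :: L').length = k + 1 := by simp at hlen' ⊢; omega
    have hs := (split_iff_idxOf rfl hn h₃).2.2
    have hs' := (split_iff_idxOf (L := L ++ t₁ :: L') (m := m') (R := []) (by simp) hn h₂).2.1
    have hn2 := hn1.2
    rw [← List.append_assoc, List.nodup_append, List.nodup_append] at hn2
    rw [e] at hs'
    rw [← hs, ← hs']
    simp only [List.mem_append, List.mem_cons, List.not_mem_nil, or_false] at h₂ h₃ htop hne ⊢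
    have h := max_mem_iff_of_top (A := (· ∈ L)) (B := (· ∈ L')) (m' := m') (t₂ := t₂) (t₃ := t₃)
      (fun x hx hx' => hn2.1.2.2 x hx x hx' rfl)
      (fun hx => hn2.2.2 m' (by simp [hx]) m' (by simp) rfl)
      (fun hx => hn2.2.2 m' (by simp [hx]) m' (by simp) rfl)
      (by rcases h₂ with h | h | h | h <;> first | omega | simp [h])
      (by rcases h₃ with h | h | h | h <;> first | omega | simp [h]) h₂₃
      (fun x hx => by
        have hx' := hne x hx
        rcases htop x (by rcases hx with h | h | h <;> simp [h]) with h | h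
        · omega
        · exact h)
    rw [h]
    refine and_congr_right ?_
    rintro rfl
    have : t₃ ≠ t₂ := by omega
    simp [this]
  constructor
  · rintro (rfl | ⟨L', m', rfl, hL', h⟩)
    · left; simp at hlen'; omega
    · by_cases h0 : L' = []
      · subst h0
        right; left; simp at hlen'; omega
      · right; right
        exact (key L' m' rfl).1 ⟨hL', List.exists_mem_of_ne_nil _ h0, h.resolve_left h0⟩
  · rintro (h | h | h)
    · left; exact List.length_eq_zero_iff.1 (by omega)
    · right
      have : R.length = 1 := by omega
      obtain ⟨b, rfl⟩ := List.length_eq_one_iff.1 this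
      exact ⟨[], b, rfl, by simp, Or.inl rfl⟩
    · right
      rcases List.eq_nil_or_concat' R with rfl | ⟨L', m', rfl⟩
      · have := List.idxOf_lt_length_iff.2 h₃
        simp only [List.length_append, List.length_cons, List.length_nil] at hlen' this
        omega
      · obtain ⟨h1, -, h3⟩ := (key L' m' rfl).2 h
        exact ⟨L', m', rfl, h1, Or.inr h3⟩

/-- For disjoint words `A` and `B` with three greatest letters `u₀ > u₁ > u₂`, the word
`S A ++ S B` of length `k + 2` survives `k` emissions if and only if `B` has at most one letter,
contains `u₀`, or contains `u₁` and `u₂`. -/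
lemma emitted_iterate_stackSort_append_ne_nil_iff {A B : List ℕ} {k u₀ u₁ u₂ : ℕ}
    (hn : (A ++ B).Nodup) (hk : 1 ≤ k) (hlen : (A ++ B).length = k + 2)
    (h₀ : u₀ ∈ A ++ B) (h₁ : u₁ ∈ A ++ B) (h₂ : u₂ ∈ A ++ B) (h₀₁ : u₁ < u₀) (h₁₂ : u₂ < u₁)
    (htop : ∀ x ∈ A ++ B, x = u₀ ∨ x = u₁ ∨ x ≤ u₂) :
    emitted^[k] (stackSort A ++ stackSort B) ≠ [] ↔
      B.length ≤ 1 ∨ u₀ ∈ B ∨ (u₁ ∈ B ∧ u₂ ∈ B) := by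
  have hA := hn.sublist (List.sublist_append_left _ _)
  have hB := hn.sublist (List.sublist_append_right _ _)
  have hp : (stackSort A ++ stackSort B).Perm (A ++ B) :=
    (stackSort_perm hA).append (stackSort_perm hB)
  have hpn := hp.nodup_iff.2 hn
  have hmax : ∀ x ∈ A ++ B, x ≤ u₀ := fun x hx => by
    rcases htop x hx with h | h | h <;> omega
  by_cases hcase : B = [] ∨ u₀ ∈ B
  · have h1 := (endsMax_stackSort_append hn h₀ hmax).2 hcase
    have h2 := emitted_iterate_ne_nil_of_endsMax hpn h1 (k := k) (by rw [hp.length_eq]; omega)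
    simp only [ne_eq, h2, not_false_eq_true, true_iff]
    rcases hcase with rfl | h
    · simp
    · exact Or.inr (Or.inl h)
  · rw [not_or] at hcase
    obtain ⟨hB0, hu₀⟩ := hcase
    have hu₀A : u₀ ∈ A := by simpa [hu₀] using h₀
    obtain ⟨Z, m, hZ, hZm⟩ := exists_stackSort_eq_append hA (List.ne_nil_of_mem hu₀A)
    obtain ⟨Z', m', hZ', hZm'⟩ := exists_stackSort_eq_append hB hB0
    have hmA : ∀ x, x ∈ A ↔ x ∈ Z ∨ x = m := fun x => by rw [← mem_stackSort hA, hZ]; simp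
    have hmB : ∀ x, x ∈ B ↔ x ∈ Z' ∨ x = m' := fun x => by rw [← mem_stackSort hB, hZ']; simp
    have hlB : B.length = Z'.length + 1 := by rw [← length_stackSort hB, hZ']; simp
    have hm : m = u₀ := by
      have h1 := hmax m (by simp [hmA])
      rcases (hmA u₀).1 hu₀A with h | h
      · have := hZm _ h; omega
      · exact h.symm
    subst hm
    have hW : stackSort A ++ stackSort B = Z ++ m :: (Z' ++ [m']) := by rw [hZ, hZ']; simp
    rw [hW] at hpn
    have hlW : (Z ++ m :: (Z' ++ [m'])).length = k + 2 := by rw [← hW, hp.length_eq, hlen]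
    have hR : ∀ x ∈ Z' ++ [m'], x < m := by
      intro x hx
      have hxB : x ∈ B := by rw [hmB]; simpa using hx
      exact lt_of_le_of_ne (hmax x (by simp [hxB])) fun e => hu₀ (e ▸ hxB)
    have hn1 := List.nodup_cons.1 (List.nodup_middle.1 hpn)
    have hn2 := hn1.2
    rw [← List.append_assoc, List.nodup_append, List.nodup_append] at hn2
    rw [hW, emitted_iterate_ne_nil_iff_of_length_eq_add_two hpn hk hlW hZm hR]
    simp only [List.mem_append, hmA, hmB] at h₀ h₁ h₂ htop
    have h := max_mem_iff_of_top (A := (· ∈ Z)) (B := (· ∈ Z')) (m' := m') (t₂ := u₁) (t₃ := u₂)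
      (fun x hx hx' => hn2.1.2.2 x hx x hx' rfl)
      (fun hx => hn2.2.2 m' (by simp [hx]) m' (by simp) rfl)
      (fun hx => hn2.2.2 m' (by simp [hx]) m' (by simp) rfl)
      (by rcases h₁ with (h | h) | h | h <;> first | omega | simp [h])
      (by rcases h₂ with (h | h) | h | h <;> first | omega | simp [h]) h₁₂
      (fun x hx => by
        rcases htop x (by rcases hx with h | h | h <;> simp [h]) with h | h
        · exfalso
          subst h
          exact hn1.1 (by simpa using hx)
        · exact h)
    have hex : (Z' ++ [m'] = [] ∨ ∃ L' m'_1, Z' ++ [m'] = L' ++ [m'_1] ∧ (∀ x ∈ L', x < m'_1) ∧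
        (L' = [] ∨ ∀ u ∈ Z ++ L', (∀ x ∈ Z ++ L', x ≤ u) → u ∈ L')) ↔
        (Z' = [] ∨ ∀ u ∈ Z ++ Z', (∀ x ∈ Z ++ Z', x ≤ u) → u ∈ Z') := by
      constructor
      · rintro (h | ⟨L', b, h, -, h2⟩)
        · simp at h
        · obtain ⟨rfl, -⟩ := List.append_inj' h rfl
          exact h2
      · exact fun h => Or.inr ⟨Z', m', rfl, hZm', h⟩
    rw [hex, hlB]
    by_cases hZ0 : Z' = []
    · simp [hZ0]
    have hZ1 : ¬ Z'.length + 1 ≤ 1 := by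
      have := List.length_pos_iff.2 hZ0
      omega
    simp only [hZ0, hZ1, hu₀, false_or, hmB, List.mem_append]
    have hex' := List.exists_mem_of_ne_nil _ hZ0
    constructor
    · intro h3
      have := h.1 ⟨hZm', hex', h3⟩
      exact ⟨Or.inr this.1, Or.inl this.2⟩
    · rintro ⟨h3, h4⟩
      -- `u₁` is the greatest letter of `B`, that is `m'`
      have h5 : u₁ = m' := by
        rcases h3 with h3 | h3
        · have h6 := hZm' _ h3
          rcases htop m' (by simp) with h7 | h7 | h7
          · exact absurd (h7 ▸ hR m' (by simp)) (lt_irrefl _)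
          · omega
          · omega
        · exact h3
      refine (h.2 ⟨h5, ?_⟩).2.2
      rcases h4 with h4 | h4
      · exact h4
      · omega

/-- The position conditions on the five greatest letters `t₁ > t₂ > t₃ > t₄ > t₅` of a word of
length `k + 3` that make the word survive `k` emissions; `pᵢ` is the position of `tᵢ`, counted from
zero. They say that the word is of one of the forms `* t₁ ⋯` with at most two letters after `t₁`,
`* t₁ * t₃ * t₂`, `* t₁ * t₃ * t₂ ?`, `* t₁ * t₄ * t₂ t₃`, `* t₁ * t₂ * t₄ * t₃`, or
`* t₂ * t₁ * t₃`, `* t₃ * t₁ * t₂` with both `t₄` and `t₅` after `t₁`. -/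
def SurvivalPositions (k p₁ p₂ p₃ p₄ p₅ : ℕ) : Prop :=
  k ≤ p₁ ∨ (p₂ = k + 2 ∧ p₁ < p₃) ∨ (p₂ = k + 1 ∧ p₁ < p₃ ∧ p₃ < k + 1) ∨
    (p₂ = k + 1 ∧ p₃ = k + 2 ∧ p₁ < p₄) ∨ (p₃ = k + 2 ∧ p₁ < p₂ ∧ p₂ < p₄) ∨
    (p₃ = k + 2 ∧ p₂ < p₁ ∧ p₁ < p₄ ∧ p₁ < p₅) ∨ (p₂ = k + 2 ∧ p₃ < p₁ ∧ p₁ < p₄ ∧ p₁ < p₅)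

/-! The left-hand sides below say, for `L t₁ L' m'` with `l` letters in `L'`, that `L'` has at most
one letter, contains the greatest of the remaining letters, or contains the next two. The last
letter `m'` is `t₂`, `t₃`, or a smaller letter, respectively. -/

lemma survivalPositions_iff_of_two_maxima₂ {k l p₁ p₂ p₃ p₄ p₅ : ℕ}
    (hl : p₁ + l = k + 2) (h₂ : p₂ = k + 3) (h₃ : p₃ < k + 3)
    (h₄ : p₄ < k + 3) (h₅ : p₅ < k + 3) (h₁₃ : p₁ ≠ p₃) :
    (l ≤ 1 ∨ (p₁ < p₃ ∧ p₃ < k + 3) ∨ ((p₁ < p₄ ∧ p₄ < k + 3) ∧ (p₁ < p₅ ∧ p₅ < k + 3))) ↔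
      SurvivalPositions (k + 1) p₁ p₂ p₃ p₄ p₅ := by
  unfold SurvivalPositions
  grind

lemma survivalPositions_iff_of_two_maxima₃ {k l p₁ p₂ p₃ p₄ p₅ : ℕ}
    (hl : p₁ + l = k + 2) (h₃ : p₃ = k + 3) (h₂ : p₂ < p₁)
    (h₄ : p₄ < k + 3) (h₅ : p₅ < k + 3) :
    (l ≤ 1 ∨ (p₁ < p₂ ∧ p₂ < k + 3) ∨ ((p₁ < p₄ ∧ p₄ < k + 3) ∧ (p₁ < p₅ ∧ p₅ < k + 3))) ↔
      SurvivalPositions (k + 1) p₁ p₂ p₃ p₄ p₅ := by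
  unfold SurvivalPositions
  grind

lemma survivalPositions_iff_of_two_maxima₄ {k l p₁ p₂ p₃ p₄ p₅ : ℕ}
    (hl : p₁ + l = k + 2) (h₂ : p₂ < p₁) (h₃ : p₃ < p₁) (q : Prop) :
    (l ≤ 1 ∨ (p₁ < p₂ ∧ p₂ < k + 3) ∨ ((p₁ < p₃ ∧ p₃ < k + 3) ∧ q)) ↔
      SurvivalPositions (k + 1) p₁ p₂ p₃ p₄ p₅ := by
  unfold SurvivalPositions
  grind

/-! The left-hand sides below say, for `L t₁ L' m' L'' m''` with `l`, `l'`, `l''` letters in `L`,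
`L'`, `L''`, that the greatest of the remaining letters is the last letter of
`S L ++ S L' ++ S L''`. Here `m' = t₂` and `m'' = t₃`, or only `m' = t₂`, or `m' < t₂`,
respectively. -/

lemma survivalPositions_iff_of_three_maxima₂₃ {k l l' l'' p₁ p₂ p₃ p₄ p₅ : ℕ} (h₁ : p₁ = l)
    (hl : l + l' + l'' = k + 1) (h₂ : p₂ = l + 1 + l')
    (h₃ : p₃ = k + 3) (h₄ : p₄ < k + 3) (h₂₄ : p₂ ≠ p₄) :
    ((l + 1 + l' < p₄ ∧ p₄ < k + 3) ∨ (l'' = 0 ∧ (l' = 0 ∨ (l < p₄ ∧ p₄ < l + 1 + l')))) ↔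
      SurvivalPositions (k + 1) p₁ p₂ p₃ p₄ p₅ := by
  unfold SurvivalPositions
  grind

lemma survivalPositions_iff_of_three_maxima₂ {k l l' l'' p₁ p₂ p₃ p₄ p₅ : ℕ} (h₁ : p₁ = l)
    (hl : l + l' + l'' = k + 1) (h₂ : p₂ = l + 1 + l')
    (h₃ : p₃ < p₂) :
    ((l + 1 + l' < p₃ ∧ p₃ < k + 3) ∨ (l'' = 0 ∧ (l' = 0 ∨ (l < p₃ ∧ p₃ < l + 1 + l')))) ↔
      SurvivalPositions (k + 1) p₁ p₂ p₃ p₄ p₅ := by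
  unfold SurvivalPositions
  grind

lemma survivalPositions_iff_of_three_maxima {k l l' l'' p₁ p₂ p₃ p₄ p₅ : ℕ} (h₁ : p₁ = l)
    (hl : l + l' + l'' = k + 1) (h₂ : p₂ < p₁)
    (h₃ : p₃ ≤ l + 1 + l') (h₃' : p₁ < p₃ → p₃ = l + 1 + l') :
    ((l + 1 + l' < p₂ ∧ p₂ < k + 3) ∨ (l'' = 0 ∧ (l' = 0 ∨ (l < p₂ ∧ p₂ < l + 1 + l')))) ↔
      SurvivalPositions (k + 1) p₁ p₂ p₃ p₄ p₅ := by
  unfold SurvivalPositions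
  grind

/-- Survival for words with exactly two right-to-left maxima `t₁` and `m'`. -/
lemma emitted_iterate_ne_nil_iff_of_two_maxima {L L' : List ℕ}
    {k t₁ t₂ t₃ t₄ t₅ m' : ℕ} (hn : (L ++ t₁ :: (L' ++ [m'])).Nodup) (hk : 1 ≤ k)
    (hlen : (L ++ t₁ :: (L' ++ [m'])).length = k + 4)
    (hL : ∀ x ∈ L, x < t₁) (hR : ∀ x ∈ L' ++ [m'], x < t₁) (hL' : ∀ x ∈ L', x < m')
    (h₂ : t₂ ∈ L ++ t₁ :: (L' ++ [m'])) (h₃ : t₃ ∈ L ++ t₁ :: (L' ++ [m']))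
    (h₄ : t₄ ∈ L ++ t₁ :: (L' ++ [m'])) (h₅ : t₅ ∈ L ++ t₁ :: (L' ++ [m']))
    (h₁₂ : t₂ < t₁) (h₂₃ : t₃ < t₂) (h₃₄ : t₄ < t₃) (h₄₅ : t₅ < t₄)
    (htop : ∀ x ∈ L ++ t₁ :: (L' ++ [m']), x = t₁ ∨ x = t₂ ∨ x = t₃ ∨ x = t₄ ∨ x ≤ t₅) :
    emitted^[k + 1] (L ++ t₁ :: (L' ++ [m'])) ≠ [] ↔
      SurvivalPositions (k + 1) ((L ++ t₁ :: (L' ++ [m'])).idxOf t₁)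
        ((L ++ t₁ :: (L' ++ [m'])).idxOf t₂) ((L ++ t₁ :: (L' ++ [m'])).idxOf t₃)
        ((L ++ t₁ :: (L' ++ [m'])).idxOf t₄) ((L ++ t₁ :: (L' ++ [m'])).idxOf t₅) := by
  have hem : emitted (L ++ t₁ :: (L' ++ [m'])) = stackSort L ++ stackSort L' := by
    rw [emitted_append_cons hL hR, emitted_of_endsMax hL']
  rw [Function.iterate_succ_apply, hem]
  generalize hQ : L ++ t₁ :: (L' ++ [m']) = Q at *
  have hm' : m' ∈ Q := by simp [← hQ]
  have hn1 : (L ++ (L' ++ [m'])).Nodup := by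
    rw [← hQ] at hn; exact (List.nodup_cons.1 (List.nodup_middle.1 hn)).2
  rw [← List.append_assoc, List.nodup_append] at hn1
  obtain ⟨hnLL, -, hmne⟩ := hn1
  have hl : L.length + L'.length = k + 2 := by
    rw [← hQ] at hlen; simp at hlen; omega
  have q : ∀ x ∈ Q, (x = t₁ ↔ Q.idxOf x = L.length) ∧
      (x ∈ L' ↔ L.length < Q.idxOf x ∧ Q.idxOf x < k + 3) ∧
      (x = m' ↔ Q.idxOf x = k + 3) ∧ (m' < x → Q.idxOf x ≤ L.length) := by
    intro x hx
    have h1 := split_iff_idxOf hQ.symm hn hx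
    have h2 := split_iff_idxOf (w := Q) (L := L ++ t₁ :: L') (m := m') (R := [])
      (by simp [← hQ]) hn hx
    have e : (L ++ t₁ :: L').length = k + 3 := by simp; omega
    rw [e] at h2
    simp only [List.mem_append, List.mem_cons, List.not_mem_nil, or_false] at h1 h2
    refine ⟨h1.2.1, ⟨fun h => ⟨h1.2.2.1 (Or.inl h), h2.1.1 (Or.inr (Or.inr h))⟩,
      fun h => ?_⟩, h2.2.1, fun h => ?_⟩
    · rcases h1.2.2.2 h.1 with h5 | h5
      · exact h5
      · have := h2.2.1.1 h5; omega
    · by_contra h5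
      rcases h1.2.2.2 (by omega) with h6 | h6
      · have := hL' x h6; omega
      · omega
  have hmem : ∀ x ∈ Q, x ≠ t₁ → x ≠ m' → x ∈ L ++ L' := by
    intro x hx h1 h2
    simpa [← hQ, h1, h2] using hx
  have hlow : ∀ x ∈ L ++ L', x ≠ t₁ ∧ x ≠ m' ∧
      (x = t₁ ∨ x = t₂ ∨ x = t₃ ∨ x = t₄ ∨ x ≤ t₅) := by
    intro x hx
    refine ⟨fun h => ?_, fun h => hmne x hx m' (by simp) h, htop x ?_⟩
    · rcases List.mem_append.1 hx with h' | h'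
      · have := hL x h'; omega
      · have := hR x (by simp [h']); omega
    · rw [← hQ]; rcases List.mem_append.1 hx with h | h <;> simp [h]
  have h₁ : t₁ ∈ Q := by simp [← hQ]
  have hinj : ∀ x ∈ Q, ∀ y, x ≠ y → Q.idxOf x ≠ Q.idxOf y :=
    fun x hx y hxy h => hxy ((List.idxOf_inj hx).1 h)
  have hlt : ∀ x ∈ Q, Q.idxOf x < k + 4 := fun x hx => hlen ▸ List.idxOf_lt_length_iff.2 hx
  have q₁ := (q _ h₁).1.1 rfl
  have hlast : ∀ x ∈ Q, x ≠ m' → Q.idxOf x < k + 3 := fun x hx h => by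
    have h1 := hlt x hx
    have h2 := mt (q x hx).2.2.1.2 h
    omega
  have hbig : ∀ x ∈ Q, x < t₁ → m' < x → Q.idxOf x < Q.idxOf t₁ := fun x hx h h' => by
    have h1 := (q x hx).2.2.2 h'
    have h2 := hinj _ h₁ x h.ne'
    omega
  have hl' : Q.idxOf t₁ + L'.length = k + 2 := by rw [q₁, hl]
  have h₁₃ := h₂₃.trans h₁₂
  have h₁₄ := h₃₄.trans h₁₃
  have h₁₅ := h₄₅.trans h₁₄
  have h₂₄ := h₃₄.trans h₂₃
  have h₂₅ := h₄₅.trans h₂₄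
  have h₃₅ := h₄₅.trans h₃₄
  have main := fun u₀ u₁ u₂ =>
    emitted_iterate_stackSort_append_ne_nil_iff (k := k) (u₀ := u₀) (u₁ := u₁) (u₂ := u₂)
      hnLL hk (by rw [List.length_append, hl])
  -- the last letter `m'` decides which letters are the three greatest ones that remain
  rcases htop m' hm' with h | h | h | h | h
  · exact absurd h (hR m' (by simp)).ne
  · rw [main t₃ t₄ t₅ (hmem _ h₃ h₁₃.ne (h ▸ h₂₃.ne)) (hmem _ h₄ h₁₄.ne (h ▸ h₂₄.ne))
      (hmem _ h₅ h₁₅.ne (h ▸ h₂₅.ne)) h₃₄ h₄₅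
      (fun x hx => by
        obtain ⟨a, b, d | d | d | d | d⟩ := hlow x hx
        · exact absurd d a
        · exact absurd (d.trans h.symm) b
        · exact Or.inl d
        · exact Or.inr (Or.inl d)
        · exact Or.inr (Or.inr d)),
      (q _ h₃).2.1, (q _ h₄).2.1, (q _ h₅).2.1, ← q₁]
    exact survivalPositions_iff_of_two_maxima₂ hl' ((q _ h₂).2.2.1.1 h.symm)
      (hlast _ h₃ (h ▸ h₂₃.ne)) (hlast _ h₄ (h ▸ h₂₄.ne)) (hlast _ h₅ (h ▸ h₂₅.ne))
      (hinj _ h₁ _ h₁₃.ne')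
  · rw [main t₂ t₄ t₅ (hmem _ h₂ h₁₂.ne (h ▸ h₂₃.ne')) (hmem _ h₄ h₁₄.ne (h ▸ h₃₄.ne))
      (hmem _ h₅ h₁₅.ne (h ▸ h₃₅.ne)) h₂₄ h₄₅
      (fun x hx => by
        obtain ⟨a, b, d | d | d | d | d⟩ := hlow x hx
        · exact absurd d a
        · exact Or.inl d
        · exact absurd (d.trans h.symm) b
        · exact Or.inr (Or.inl d)
        · exact Or.inr (Or.inr d)),
      (q _ h₂).2.1, (q _ h₄).2.1, (q _ h₅).2.1, ← q₁]
    exact survivalPositions_iff_of_two_maxima₃ hl' ((q _ h₃).2.2.1.1 h.symm)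
      (hbig _ h₂ h₁₂ (h ▸ h₂₃)) (hlast _ h₄ (h ▸ h₃₄.ne)) (hlast _ h₅ (h ▸ h₃₅.ne))
  · rw [main t₂ t₃ t₅ (hmem _ h₂ h₁₂.ne (h ▸ h₂₄.ne')) (hmem _ h₃ h₁₃.ne (h ▸ h₃₄.ne'))
      (hmem _ h₅ h₁₅.ne (h ▸ h₄₅.ne)) h₂₃ h₃₅
      (fun x hx => by
        obtain ⟨a, b, d | d | d | d | d⟩ := hlow x hx
        · exact absurd d a
        · exact Or.inl d
        · exact Or.inr (Or.inl d)
        · exact absurd (d.trans h.symm) b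
        · exact Or.inr (Or.inr d)),
      (q _ h₂).2.1, (q _ h₃).2.1, ← q₁]
    exact survivalPositions_iff_of_two_maxima₄ hl' (hbig _ h₂ h₁₂ (h ▸ h₂₄))
      (hbig _ h₃ h₁₃ (h ▸ h₃₄)) _
  · have h' := h.trans_lt h₄₅
    rw [main t₂ t₃ t₄ (hmem _ h₂ h₁₂.ne (h'.trans h₂₄).ne') (hmem _ h₃ h₁₃.ne (h'.trans h₃₄).ne')
      (hmem _ h₄ h₁₄.ne h'.ne') h₂₃ h₃₄
      (fun x hx => by
        obtain ⟨a, b, d | d | d | d | d⟩ := hlow x hx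
        · exact absurd d a
        · exact Or.inl d
        · exact Or.inr (Or.inl d)
        · exact Or.inr (Or.inr d.le)
        · exact Or.inr (Or.inr (d.trans h₄₅.le))),
      (q _ h₂).2.1, (q _ h₃).2.1, ← q₁]
    exact survivalPositions_iff_of_two_maxima₄ hl' (hbig _ h₂ h₁₂ (h'.trans h₂₄))
      (hbig _ h₃ h₁₃ (h'.trans h₃₄)) _

/-- Survival for words with exactly three right-to-left maxima `t₁`, `m'` and `m''`. -/
lemma emitted_iterate_ne_nil_iff_of_three_maxima {L L' L'' : List ℕ}
    {k t₁ t₂ t₃ t₄ t₅ m' m'' : ℕ} (hn : (L ++ t₁ :: (L' ++ m' :: (L'' ++ [m'']))).Nodup)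
    (hlen : (L ++ t₁ :: (L' ++ m' :: (L'' ++ [m'']))).length = k + 4)
    (hL : ∀ x ∈ L, x < t₁) (hR : ∀ x ∈ L' ++ m' :: (L'' ++ [m'']), x < t₁)
    (hL' : ∀ x ∈ L', x < m') (hR' : ∀ x ∈ L'' ++ [m''], x < m') (hL'' : ∀ x ∈ L'', x < m'')
    (h₂ : t₂ ∈ L ++ t₁ :: (L' ++ m' :: (L'' ++ [m''])))
    (h₃ : t₃ ∈ L ++ t₁ :: (L' ++ m' :: (L'' ++ [m''])))
    (h₄ : t₄ ∈ L ++ t₁ :: (L' ++ m' :: (L'' ++ [m''])))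
    (h₁₂ : t₂ < t₁) (h₂₃ : t₃ < t₂) (h₃₄ : t₄ < t₃) (h₄₅ : t₅ < t₄)
    (htop : ∀ x ∈ L ++ t₁ :: (L' ++ m' :: (L'' ++ [m''])),
      x = t₁ ∨ x = t₂ ∨ x = t₃ ∨ x = t₄ ∨ x ≤ t₅) :
    emitted^[k + 1] (L ++ t₁ :: (L' ++ m' :: (L'' ++ [m'']))) ≠ [] ↔
      SurvivalPositions (k + 1) ((L ++ t₁ :: (L' ++ m' :: (L'' ++ [m'']))).idxOf t₁)
        ((L ++ t₁ :: (L' ++ m' :: (L'' ++ [m'']))).idxOf t₂)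
        ((L ++ t₁ :: (L' ++ m' :: (L'' ++ [m'']))).idxOf t₃)
        ((L ++ t₁ :: (L' ++ m' :: (L'' ++ [m'']))).idxOf t₄)
        ((L ++ t₁ :: (L' ++ m' :: (L'' ++ [m'']))).idxOf t₅) := by
  have hem : emitted (L ++ t₁ :: (L' ++ m' :: (L'' ++ [m'']))) =
      stackSort L ++ stackSort L' ++ stackSort L'' := by
    rw [emitted_append_cons hL hR, emitted_append_cons hL' hR', emitted_of_endsMax hL'',
      List.append_assoc]
  have hemn := emitted_nodup hn
  rw [Function.iterate_succ_apply, hem] at *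
  generalize hQ : L ++ t₁ :: (L' ++ m' :: (L'' ++ [m''])) = Q at *
  have hm' : m' ∈ Q := by simp [← hQ]
  have hm'' : m'' ∈ Q := by simp [← hQ]
  have hnL : (L ++ L' ++ L'').Nodup := by
    rw [List.append_assoc]
    rw [← hQ] at hn
    refine hn.sublist (List.Sublist.append (List.Sublist.refl L) ?_)
    refine List.Sublist.cons _ (List.Sublist.append (List.Sublist.refl L') ?_)
    exact List.Sublist.cons _ (List.sublist_append_left _ _)
  have hl : L.length + L'.length + L''.length = k + 1 := by
    rw [← hQ] at hlen; simp at hlen; omega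
  have hlem : (stackSort L ++ stackSort L' ++ stackSort L'').length = k + 1 := by
    simp only [List.nodup_append] at hnL
    rw [List.length_append, List.length_append, length_stackSort hnL.1.1,
      length_stackSort hnL.1.2.1, length_stackSort hnL.2.1, hl]
  have q : ∀ x ∈ Q, (x = t₁ ↔ Q.idxOf x = L.length) ∧
      (x ∈ L' ↔ L.length < Q.idxOf x ∧ Q.idxOf x < L.length + 1 + L'.length) ∧
      (x = m' ↔ Q.idxOf x = L.length + 1 + L'.length) ∧
      (x ∈ L'' ↔ L.length + 1 + L'.length < Q.idxOf x ∧ Q.idxOf x < k + 3) ∧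
      (x = m'' ↔ Q.idxOf x = k + 3) ∧ (m' < x → Q.idxOf x ≤ L.length) ∧
      (m'' < x → Q.idxOf x ≤ L.length + 1 + L'.length) := by
    intro x hx
    have h1 := split_iff_idxOf hQ.symm hn hx
    have h2 := split_iff_idxOf (w := Q) (L := L ++ t₁ :: L') (m := m') (R := L'' ++ [m''])
      (by simp [← hQ]) hn hx
    have h3 := split_iff_idxOf (w := Q) (L := L ++ t₁ :: (L' ++ m' :: L'')) (m := m'') (R := [])
      (by simp [← hQ]) hn hx
    have e : (L ++ t₁ :: L').length = L.length + 1 + L'.length := by simp; omega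
    have e' : (L ++ t₁ :: (L' ++ m' :: L'')).length = k + 3 := by simp; omega
    rw [e] at h2
    rw [e'] at h3
    simp only [List.mem_append, List.mem_cons, List.not_mem_nil, or_false] at h1 h2 h3
    refine ⟨h1.2.1, ⟨fun h => ⟨h1.2.2.1 (Or.inl h), h2.1.1 (Or.inr (Or.inr h))⟩,
      fun h => ?_⟩, h2.2.1, ⟨fun h => ⟨h2.2.2.1 (Or.inl h), h3.1.1 (by simp [h])⟩,
      fun h => ?_⟩, h3.2.1, fun h => ?_, fun h => ?_⟩
    · rcases h2.1.2 h.2 with h5 | h5 | h5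
      · have := h1.1.1 h5; omega
      · have := h1.2.1.1 h5; omega
      · exact h5
    · rcases h2.2.2.2 h.1 with h5 | h5
      · exact h5
      · have := h3.2.1.1 h5; omega
    · by_contra h5
      rcases h1.2.2.2 (by omega) with h6 | h6 | h6
      · have := hL' x h6; omega
      · omega
      · have := hR' x (by simpa using h6); omega
    · by_contra h5
      rcases h2.2.2.2 (by omega) with h6 | h6
      · have := hL'' x h6; omega
      · omega
  have hmem : ∀ x ∈ Q, x ≠ t₁ → x ≠ m' → x ≠ m'' → x ∈ L ++ L' ++ L'' := by
    intro x hx h1 h2 h3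
    simpa [← hQ, h1, h2, h3] using hx
  have hlow : ∀ x ∈ L ++ L' ++ L'', x ≠ t₁ ∧ x ≠ m' ∧ x ≠ m'' ∧
      (x = t₁ ∨ x = t₂ ∨ x = t₃ ∨ x = t₄ ∨ x ≤ t₅) := by
    intro x hx
    have hxQ : x ∈ Q := by
      rw [← hQ]; simp only [List.mem_append] at hx; rcases hx with (h | h) | h <;> simp [h]
    have hq := q x hxQ
    have hL : x ∈ L → Q.idxOf x < L.length := fun h => by
      rw [← hQ]; exact mem_left_iff_idxOf_lt.1 h
    simp only [List.mem_append, or_assoc] at hx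
    have : x ≠ t₁ ∧ x ≠ m' ∧ x ≠ m'' := by
      rw [Ne, Ne, Ne, hq.1, hq.2.2.1, hq.2.2.2.2.1]
      rcases hx with h | h | h
      · have := hL h; omega
      · have := hq.2.1.1 h; omega
      · have := hq.2.2.2.1.1 h; omega
    exact ⟨this.1, this.2.1, this.2.2, htop x hxQ⟩
  have h₁ : t₁ ∈ Q := by simp [← hQ]
  have hinj : ∀ x ∈ Q, ∀ y, x ≠ y → Q.idxOf x ≠ Q.idxOf y :=
    fun x hx y hxy h => hxy ((List.idxOf_inj hx).1 h)
  have hlt : ∀ x ∈ Q, Q.idxOf x < k + 4 := fun x hx => hlen ▸ List.idxOf_lt_length_iff.2 hx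
  have q₁ := (q _ h₁).1.1 rfl
  have hlast : ∀ x ∈ Q, x ≠ m'' → Q.idxOf x < k + 3 := fun x hx h => by
    have h1 := hlt x hx
    have h2 := mt (q x hx).2.2.2.2.1.2 h
    omega
  have hcut : ∀ x ∈ Q, x < t₁ → m' < x → Q.idxOf x < Q.idxOf t₁ := fun x hx h h' => by
    have h1 := (q x hx).2.2.2.2.2.1 h'
    have h2 := hinj _ h₁ x h.ne'
    omega
  have h₁₃ := h₂₃.trans h₁₂
  have h₁₄ := h₃₄.trans h₁₃
  have h₂₄ := h₃₄.trans h₂₃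
  have hm't := hR m' (by simp)
  have hm''m' := hR' m'' (by simp)
  have tm' := htop m' hm'
  have tm'' := htop m'' hm''
  have hL0 : L' = [] ↔ L'.length = 0 := List.length_eq_zero_iff.symm
  have hL0' : L'' = [] ↔ L''.length = 0 := List.length_eq_zero_iff.symm
  -- the greatest remaining letter is `t₂`, `t₃` or `t₄`
  have main := fun u hu hmax => (emitted_iterate_ne_nil_iff_endsMax hemn hlem).trans
    (endsMax_stackSort_append₃ (u := u) hnL hu hmax)
  by_cases h2m : t₂ = m'
  · have e := (q _ h₂).2.2.1.1 h2m
    by_cases h3m : t₃ = m''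
    · rw [main t₄ (hmem _ h₄ h₁₄.ne (h2m ▸ h₂₄.ne) (h3m ▸ h₃₄.ne))
        (fun x hx => by
          obtain ⟨a, b, c, d | d | d | d | d⟩ := hlow x hx
          · exact absurd d a
          · exact absurd (d.trans h2m) b
          · exact absurd (d.trans h3m) c
          · exact d.le
          · exact d.trans h₄₅.le), (q _ h₄).2.1, (q _ h₄).2.2.2.1, hL0, hL0']
      exact survivalPositions_iff_of_three_maxima₂₃ q₁ hl e ((q _ h₃).2.2.2.2.1.1 h3m)
        (hlast _ h₄ (h3m ▸ h₃₄.ne)) (hinj _ h₂ _ h₂₄.ne')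
    · have e' : m'' < t₃ := by clear main q; omega
      rw [main t₃ (hmem _ h₃ h₁₃.ne (h2m ▸ h₂₃.ne) h3m)
        (fun x hx => by
          obtain ⟨a, b, c, d | d | d | d | d⟩ := hlow x hx
          · exact absurd d a
          · exact absurd (d.trans h2m) b
          · exact d.le
          · exact d.trans_le h₃₄.le
          · exact d.trans (h₄₅.trans h₃₄).le), (q _ h₃).2.1, (q _ h₃).2.2.2.1, hL0, hL0']
      refine survivalPositions_iff_of_three_maxima₂ q₁ hl e (lt_of_le_of_ne ?_ (hinj _ h₃ _ h₂₃.ne))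
      rw [e]
      exact (q _ h₃).2.2.2.2.2.2 e'
  · have hm't₂ : m' < t₂ := by clear main q; omega
    have hm''t₃ : m'' < t₃ := by clear main q; omega
    rw [main t₂ (hmem _ h₂ h₁₂.ne h2m (hm''m'.trans hm't₂).ne')
        (fun x hx => by
          obtain ⟨a, b, c, d | d | d | d | d⟩ := hlow x hx
          · exact absurd d a
          · exact d.le
          · exact d.trans_le h₂₃.le
          · exact d.trans_le h₂₄.le
          · exact d.trans (h₄₅.trans h₂₄).le), (q _ h₂).2.1, (q _ h₂).2.2.2.1, hL0, hL0']
    refine survivalPositions_iff_of_three_maxima q₁ hl (hcut _ h₂ h₁₂ hm't₂)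
      ((q _ h₃).2.2.2.2.2.2 hm''t₃) fun h => (q _ h₃).2.2.1.1 ?_
    have h3 := mt (hcut _ h₃ h₁₃) (by omega)
    clear main q
    omega

/-- A word of length at most `k + 4` with at least four right-to-left maxima does not survive
`k + 1` emissions. -/
lemma emitted_iterate_eq_nil_of_four_maxima {L L' L'' R : List ℕ} {k m m' m'' : ℕ}
    (hn : (L ++ m :: (L' ++ m' :: (L'' ++ m'' :: R))).Nodup)
    (hlen : (L ++ m :: (L' ++ m' :: (L'' ++ m'' :: R))).length ≤ k + 4)
    (hL : ∀ x ∈ L, x < m) (hR : ∀ x ∈ L' ++ m' :: (L'' ++ m'' :: R), x < m)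
    (hL' : ∀ x ∈ L', x < m') (hR' : ∀ x ∈ L'' ++ m'' :: R, x < m')
    (hL'' : ∀ x ∈ L'', x < m'') (hR'' : ∀ x ∈ R, x < m'') (hR0 : R ≠ []) :
    emitted^[k + 1] (L ++ m :: (L' ++ m' :: (L'' ++ m'' :: R))) = [] := by
  have h1 := length_emitted_append_cons_append_cons hn hL hR hL' hR'
  have h2 := emitted_append_cons hL'' hR''
  have hn' := hn
  simp only [List.nodup_append, List.nodup_cons] at hn'
  have h3 := length_emitted_lt hn'.2.1.2.2.1.2.2.1.2 hR0
  rw [h2, List.length_append, length_stackSort hn'.2.1.2.2.1.2.1] at h1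
  simp only [List.length_append, List.length_cons] at hlen
  rw [Function.iterate_succ_apply]
  exact emitted_iterate_eq_nil (emitted_nodup hn) (by omega)

/-- A word of length `k + 3` with at least four right-to-left maxima is of none of the forms that
survive. -/
lemma not_survivalPositions_of_four_maxima {L L' L'' R : List ℕ} {k t₁ t₂ t₃ m' m'' p₄ p₅ : ℕ}
    {Q : List ℕ} (hQ : Q = L ++ t₁ :: (L' ++ m' :: (L'' ++ m'' :: R)))
    (hn : Q.Nodup) (hlen : Q.length = k + 3)
    (hR' : ∀ x ∈ L'' ++ m'' :: R, x < m')
    (hR'' : ∀ x ∈ R, x < m'') (hR0 : R ≠ []) (h₂ : t₂ ∈ Q) (h₃ : t₃ ∈ Q) (h₂₃ : t₃ < t₂)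
    (htop : ∀ x ∈ Q, x = t₁ ∨ x = t₂ ∨ x ≤ t₃) (hR : ∀ x ∈ L' ++ m' :: (L'' ++ m'' :: R), x < t₁) :
    ¬ SurvivalPositions k (Q.idxOf t₁) (Q.idxOf t₂) (Q.idxOf t₃) p₄ p₅ := by
  have h₁ : t₁ ∈ Q := by simp [hQ]
  have hR0' := List.length_pos_iff.2 hR0
  have e₁ : Q.idxOf t₁ = L.length := (split_iff_idxOf hQ hn h₁).2.1.1 rfl
  have hl : L.length + 1 + L'.length + 1 + L''.length + 1 + R.length = k + 3 := by
    rw [hQ] at hlen; simp at hlen; omega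
  have key : ∀ x ∈ Q, (Q.idxOf x = L.length + 1 + L'.length → x = m') ∧
      (k + 1 ≤ Q.idxOf x → x < m') ∧ (k + 2 ≤ Q.idxOf x → x < m'') := by
    intro x hx
    have s1 := split_iff_idxOf (L := L ++ t₁ :: L') (m := m') (R := L'' ++ m'' :: R)
      (by simp [hQ]) hn hx
    have s2 := split_iff_idxOf (L := L ++ t₁ :: (L' ++ m' :: L'')) (m := m'') (R := R)
      (by simp [hQ]) hn hx
    have e : (L ++ t₁ :: L').length = L.length + 1 + L'.length := by simp; omega
    have e' : (L ++ t₁ :: (L' ++ m' :: L'')).length =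
        L.length + 1 + L'.length + 1 + L''.length := by
      simp; omega
    rw [e] at s1
    rw [e'] at s2
    exact ⟨s1.2.1.2, fun h => hR' x (s1.2.2.2 (by omega)), fun h => hR'' x (s2.2.2.2 (by omega))⟩
  have hm' : m' ∈ Q := by simp [hQ]
  have hm'' : m'' ∈ Q := by simp [hQ]
  have hm't := hR m' (by simp)
  have hm''m' := hR' m'' (by simp)
  have t' := htop m' hm'
  have t'' := htop m'' hm''
  have k₂ := key _ h₂
  have k₃ := key _ h₃
  clear key hR hR' hR'' htop
  unfold SurvivalPositions
  grind

/-- Words of length `k + 3` that survive `k` emissions, in terms of the positions of their five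
greatest letters. -/
lemma emitted_iterate_ne_nil_iff_survivalPositions {Q : List ℕ} {k t₁ t₂ t₃ t₄ t₅ : ℕ}
    (hn : Q.Nodup) (hk : 2 ≤ k) (hlen : Q.length = k + 3) (h₁ : t₁ ∈ Q) (h₂ : t₂ ∈ Q) (h₃ : t₃ ∈ Q)
    (h₄ : t₄ ∈ Q) (h₅ : t₅ ∈ Q) (h₁₂ : t₂ < t₁) (h₂₃ : t₃ < t₂) (h₃₄ : t₄ < t₃) (h₄₅ : t₅ < t₄)
    (htop : ∀ x ∈ Q, x = t₁ ∨ x = t₂ ∨ x = t₃ ∨ x = t₄ ∨ x ≤ t₅) :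
    emitted^[k] Q ≠ [] ↔
      SurvivalPositions k (Q.idxOf t₁) (Q.idxOf t₂) (Q.idxOf t₃) (Q.idxOf t₄) (Q.idxOf t₅) := by
  obtain ⟨j, rfl⟩ : ∃ j, k = j + 1 := ⟨k - 1, by omega⟩
  obtain ⟨L, R, rfl⟩ := List.append_of_mem h₁
  have hn1 := List.nodup_cons.1 (List.nodup_middle.1 hn)
  have hne : ∀ x ∈ L ++ R, x < t₁ := by
    intro x hx
    have h2 : x ≠ t₁ := by
      rintro rfl; exact hn1.1 hx
    have h3 : x ∈ L ++ t₁ :: R := by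
      rcases List.mem_append.1 hx with h | h <;> simp [h]
    rcases htop x h3 with h | h | h | h | h <;> omega
  have hL : ∀ x ∈ L, x < t₁ := fun x hx => hne x (by simp [hx])
  have hR : ∀ x ∈ R, x < t₁ := fun x hx => hne x (by simp [hx])
  by_cases hR0 : R = []
  · subst hR0
    have h := emitted_iterate_ne_nil_of_endsMax hn ⟨L, t₁, rfl, hL⟩ (k := j + 1) (by omega)
    have hl : L.length = j + 3 := by simpa using hlen
    have hi := idxOf_append_cons_self hn
    simp only [ne_eq, h, not_false_eq_true, true_iff]
    left; omega
  have hRn : R.Nodup := hn1.2.sublist (List.sublist_append_right _ _)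
  obtain ⟨L', m', R', rfl, hL', hR'⟩ := exists_max_split hRn hR0
  by_cases hR'0 : R' = []
  · subst hR'0
    exact emitted_iterate_ne_nil_iff_of_two_maxima hn (by omega) hlen hL hR hL' h₂ h₃ h₄ h₅ h₁₂ h₂₃
      h₃₄ h₄₅ htop
  have hR'n : R'.Nodup := hRn.sublist
    ((List.sublist_cons_self _ _).trans (List.sublist_append_right _ _))
  obtain ⟨L'', m'', R'', rfl, hL'', hR''⟩ := exists_max_split hR'n hR'0
  by_cases hR''0 : R'' = []
  · subst hR''0
    exact emitted_iterate_ne_nil_iff_of_three_maxima hn hlen hL hR hL' hR' hL'' h₂ h₃ h₄ h₁₂ h₂₃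
      h₃₄ h₄₅ htop
  · have h := not_survivalPositions_of_four_maxima
      (p₄ := (L ++ t₁ :: (L' ++ m' :: (L'' ++ m'' :: R''))).idxOf t₄)
      (p₅ := (L ++ t₁ :: (L' ++ m' :: (L'' ++ m'' :: R''))).idxOf t₅)
      rfl hn hlen hR' hR'' hR''0 h₂ h₃ h₂₃
      (fun x hx => by rcases htop x hx with h | h | h | h | h <;> omega) hR
    simp [h, emitted_iterate_eq_nil_of_four_maxima hn hlen.le hL hR hL' hR' hL'' hR'' hR''0]

/-! ### Unsorted permutations in terms of positions of letters -/

/-- The word before the letter `a`: its length, its letters, and their positions in it. -/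
lemma take_idxOf_facts {v : List ℕ} (hv : v.Nodup) {a : ℕ} (ha : a ∈ v) :
    (v.take (v.idxOf a)).Nodup ∧ (v.take (v.idxOf a)).length = v.idxOf a ∧
      (∀ x ∈ v.take (v.idxOf a), x ∈ v ∧ v.idxOf x < v.idxOf a) ∧
      ∀ x, v.idxOf x < v.idxOf a → x ∈ v.take (v.idxOf a) ∧
        (v.take (v.idxOf a)).idxOf x = v.idxOf x := by
  have hlen : (v.take (v.idxOf a)).length = v.idxOf a := by
    have := List.idxOf_lt_length_iff.2 ha
    simp; omega
  have hs := eq_take_append_cons ha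
  have hmem : ∀ x, x ∈ v.take (v.idxOf a) ↔ v.idxOf x < v.idxOf a := by
    intro x
    have h := mem_left_iff_idxOf_lt (L := v.take (v.idxOf a)) (m := a)
      (R := v.drop (v.idxOf a + 1)) (x := x)
    rwa [← hs, hlen] at h
  refine ⟨hv.sublist (List.take_sublist _ _), hlen,
    fun x hx => ⟨List.mem_of_mem_take hx, (hmem x).1 hx⟩, fun x hx => ⟨(hmem x).2 hx, ?_⟩⟩
  conv_rhs => rw [hs, List.idxOf_append_of_mem ((hmem x).2 hx)]

lemma emitted_iterate_take_ne_nil_iff₀ {v : List ℕ} (hv : v.Nodup) {a k u : ℕ} (ha : a ∈ v)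
    (hak : v.idxOf a = k + 1) (hu : v.idxOf u < v.idxOf a)
    (htop : ∀ x ∈ v, v.idxOf x < v.idxOf a → x ≤ u) :
    emitted^[k] (v.take (v.idxOf a)) ≠ [] ↔ v.idxOf u = k := by
  obtain ⟨hn, hl, h1, h2⟩ := take_idxOf_facts hv ha
  obtain ⟨huQ, hui⟩ := h2 u hu
  rw [emitted_iterate_ne_nil_iff_endsMax hn (hl.trans hak), ← hui]
  generalize v.take (v.idxOf a) = Q at *
  have hmax : ∀ x ∈ Q, x ≤ u := fun x hx => htop x (h1 x hx).1 (h1 x hx).2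
  rw [endsMax_iff_getLast? hn huQ hmax, List.getLast?_eq_some_iff]
  constructor
  · rintro ⟨L, rfl⟩
    have := idxOf_append_cons_self (R := []) hn
    simp at hl
    omega
  · intro h
    obtain ⟨L, R, rfl⟩ := List.append_of_mem huQ
    have h3 := idxOf_append_cons_self hn
    simp only [List.length_append, List.length_cons] at hl
    have : R = [] := List.length_eq_zero_iff.1 (by omega)
    exact ⟨L, by rw [this]⟩

lemma emitted_iterate_take_ne_nil_iff₁ {v : List ℕ} (hv : v.Nodup) {a k t₁ t₂ t₃ : ℕ} (ha : a ∈ v)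
    (hk : 1 ≤ k) (hak : v.idxOf a = k + 2) (h₁ : v.idxOf t₁ < v.idxOf a)
    (h₂ : v.idxOf t₂ < v.idxOf a) (h₃ : v.idxOf t₃ < v.idxOf a) (h₁₂ : t₂ < t₁) (h₂₃ : t₃ < t₂)
    (htop : ∀ x ∈ v, v.idxOf x < v.idxOf a → x = t₁ ∨ x = t₂ ∨ x ≤ t₃) :
    emitted^[k] (v.take (v.idxOf a)) ≠ [] ↔ v.idxOf t₁ = k + 1 ∨ v.idxOf t₁ = k ∨
      (v.idxOf t₂ = k + 1 ∧ v.idxOf t₁ < v.idxOf t₃) := by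
  obtain ⟨hn, hl, hf, hb⟩ := take_idxOf_facts hv ha
  rw [emitted_iterate_ne_nil_iff₁ hn hk (hl.trans hak) (hb _ h₁).1 (hb _ h₂).1 (hb _ h₃).1 h₁₂ h₂₃
    (fun x hx => htop x (hf x hx).1 (hf x hx).2), (hb _ h₁).2, (hb _ h₂).2, (hb _ h₃).2]

lemma emitted_iterate_take_ne_nil_iff₂ {v : List ℕ} (hv : v.Nodup) {a k t₁ t₂ t₃ t₄ t₅ : ℕ}
    (ha : a ∈ v) (hk : 2 ≤ k) (hak : v.idxOf a = k + 3) (h₁ : v.idxOf t₁ < v.idxOf a)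
    (h₂ : v.idxOf t₂ < v.idxOf a) (h₃ : v.idxOf t₃ < v.idxOf a) (h₄ : v.idxOf t₄ < v.idxOf a)
    (h₅ : v.idxOf t₅ < v.idxOf a) (h₁₂ : t₂ < t₁) (h₂₃ : t₃ < t₂) (h₃₄ : t₄ < t₃) (h₄₅ : t₅ < t₄)
    (htop : ∀ x ∈ v, v.idxOf x < v.idxOf a → x = t₁ ∨ x = t₂ ∨ x = t₃ ∨ x = t₄ ∨ x ≤ t₅) :
    emitted^[k] (v.take (v.idxOf a)) ≠ [] ↔
      SurvivalPositions k (v.idxOf t₁) (v.idxOf t₂) (v.idxOf t₃) (v.idxOf t₄) (v.idxOf t₅) := by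
  obtain ⟨hn, hl, hf, hb⟩ := take_idxOf_facts hv ha
  rw [emitted_iterate_ne_nil_iff_survivalPositions hn hk (hl.trans hak) (hb _ h₁).1 (hb _ h₂).1
    (hb _ h₃).1 (hb _ h₄).1 (hb _ h₅).1 h₁₂ h₂₃ h₃₄ h₄₅
    (fun x hx => htop x (hf x hx).1 (hf x hx).2), (hb _ h₁).2, (hb _ h₂).2, (hb _ h₃).2,
    (hb _ h₄).2, (hb _ h₅).2]

lemma idxOf_erase {w : List ℕ} (hw : w.Nodup) {x y : ℕ} (hxy : x ≠ y) :
    (w.erase y).idxOf x = if w.idxOf y < w.idxOf x then w.idxOf x - 1 else w.idxOf x := by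
  induction w with
  | nil => simp
  | cons b w ih =>
    have ih := ih (List.nodup_cons.1 hw).2
    by_cases hby : b = y
    · subst hby
      simp [List.idxOf_cons_ne _ hxy.symm]
    · rw [List.erase_cons_tail (by simpa using hby)]
      by_cases hbx : b = x
      · subst hbx; simp
      · rw [List.idxOf_cons_ne _ hbx, List.idxOf_cons_ne _ hbx, List.idxOf_cons_ne _ hby, ih]
        split_ifs <;> omega

lemma mem_idWord {n x : ℕ} : x ∈ idWord n ↔ 1 ≤ x ∧ x ≤ n := by
  simp only [idWord, List.mem_range'_1]; omega

lemma filter_succ_le_eq_erase {w : List ℕ} (hw : w.Nodup) (a : ℕ) :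
    w.filter (a + 1 ≤ ·) = (w.filter (a ≤ ·)).erase a := by
  rw [(hw.filter _).erase_eq_filter, List.filter_filter]
  refine List.filter_congr fun x _ => ?_
  rw [Bool.eq_iff_iff]
  simp only [decide_eq_true_eq, Bool.and_eq_true, bne_iff_ne]
  omega

lemma filter_one_le_eq_self {n : ℕ} {w : List ℕ} (hw : w.Perm (idWord n)) :
    w.filter (1 ≤ ·) = w := by
  rw [List.filter_eq_self]
  intro x hx
  simpa using (mem_idWord.1 (hw.mem_iff.1 hx)).1

lemma length_largerBefore_le {n a : ℕ} {w : List ℕ} (hw : w.Perm (idWord n)) (ha : a ∈ w) :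
    (largerBefore a w).length ≤ n - a := by
  have hn : w.Nodup := hw.nodup_iff.2 (idWord_nodup n)
  obtain ⟨R, hR, h1, -⟩ := filter_eq_largerBefore hn ha
  have hn' : (largerBefore a w).Nodup := (hn.filter _).sublist (List.take_sublist _ _)
  rw [← List.toFinset_card_of_nodup hn', ← Nat.card_Ioc]
  refine Finset.card_le_card fun x hx => ?_
  rw [List.mem_toFinset] at hx
  have h2 : x ∈ w := List.mem_of_mem_filter (List.mem_of_mem_take hx)
  rw [Finset.mem_Ioc]
  exact ⟨h1 x hx, (mem_idWord.1 (hw.mem_iff.1 h2)).2⟩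

lemma largerBefore_nodup {w : List ℕ} (hw : w.Nodup) (a : ℕ) : (largerBefore a w).Nodup :=
  (hw.filter _).sublist (List.take_sublist _ _)

/-- Only the letters `1`, `2`, `3` can prevent `n - 4` passes from sorting a permutation, since
fewer than `n - 3` larger letters stand before any other letter. -/
lemma not_sorted_iff {n : ℕ} (hn : 6 ≤ n) {w : List ℕ} (hw : w.Perm (idWord n)) :
    stackSort^[n - 4] w ≠ idWord n ↔
      emitted^[n - 4] (w.take (w.idxOf 1)) ≠ [] ∨
      emitted^[n - 4] ((w.erase 1).take ((w.erase 1).idxOf 2)) ≠ [] ∨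
      emitted^[n - 4] (((w.erase 1).erase 2).take (((w.erase 1).erase 2).idxOf 3)) ≠ [] := by
  have hnd : w.Nodup := hw.nodup_iff.2 (idWord_nodup n)
  have hmem : ∀ x, x ∈ w ↔ 1 ≤ x ∧ x ≤ n := fun x => hw.mem_iff.trans mem_idWord
  have e₁ : largerBefore 1 w = w.take (w.idxOf 1) := by
    rw [largerBefore, filter_one_le_eq_self hw]
  have e₂ : largerBefore 2 w = (w.erase 1).take ((w.erase 1).idxOf 2) := by
    rw [largerBefore, filter_succ_le_eq_erase hnd 1, filter_one_le_eq_self hw]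
  have e₃ : largerBefore 3 w =
      ((w.erase 1).erase 2).take (((w.erase 1).erase 2).idxOf 3) := by
    rw [largerBefore, filter_succ_le_eq_erase hnd 2, filter_succ_le_eq_erase hnd 1,
      filter_one_le_eq_self hw]
  rw [Ne, stackSort_iterate_eq_idWord_iff hw, ← e₁, ← e₂, ← e₃]
  constructor
  · intro h
    push Not at h
    obtain ⟨a, ha, h⟩ := h
    have ha4 : a < 4 := by
      by_contra h4
      refine h (emitted_iterate_eq_nil (largerBefore_nodup hnd a) ?_)
      have := length_largerBefore_le hw ha
      omega
    have ha1 := ((hmem a).1 ha).1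
    interval_cases a
    · exact Or.inl h
    · exact Or.inr (Or.inl h)
    · exact Or.inr (Or.inr h)
  · rintro (h | h | h) h'
    · exact h (h' 1 ((hmem 1).2 (by omega)))
    · exact h (h' 2 ((hmem 2).2 (by omega)))
    · exact h (h' 3 ((hmem 3).2 (by omega)))

/-- The permutations that the letter `1` keeps from being sorted by `n - 4` passes, in terms of the
position `p x` of each letter `x`. -/
def UnsortedAtOne (n : ℕ) (p : ℕ → ℕ) : Prop :=
  (p 1 = n - 1 ∧ SurvivalPositions (n - 4) (p n) (p (n - 1)) (p (n - 2)) (p (n - 3)) (p (n - 4))) ∨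
  (p 1 = n - 2 ∧ p n = n - 1 ∧ (p (n - 1) = n - 3 ∨ p (n - 1) = n - 4 ∨
    (p (n - 2) = n - 3 ∧ p (n - 1) < p (n - 3)))) ∨
  (p 1 = n - 2 ∧ p n ≠ n - 1 ∧ (p n = n - 3 ∨ p n = n - 4 ∨
    (p (n - 1) = n - 1 ∧ p (n - 2) = n - 3 ∧ p n < p (n - 3)) ∨
    (p (n - 2) = n - 1 ∧ p (n - 1) = n - 3 ∧ p n < p (n - 3)) ∨
    (p (n - 2) < n - 1 ∧ p (n - 1) = n - 3 ∧ p n < p (n - 2)))) ∨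
  (p 1 = n - 3 ∧ (p n = n - 4 ∨ (n - 3 < p n ∧ (p (n - 1) = n - 4 ∨
    (n - 3 < p (n - 1) ∧ p (n - 2) = n - 4)))))

/-- The permutations that the letter `2` keeps from being sorted by `n - 4` passes; `q` gives the
positions of the letters after the letter `1` has been deleted. -/
def UnsortedAtTwo (n : ℕ) (q : ℕ → ℕ) : Prop :=
  (q 2 = n - 2 ∧ (q n = n - 3 ∨ q n = n - 4 ∨ (q (n - 1) = n - 3 ∧ q n < q (n - 2)))) ∨
  (q 2 = n - 3 ∧ (q n = n - 4 ∨ (q n = n - 2 ∧ q (n - 1) = n - 4)))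

set_option maxHeartbeats 1000000 in
/-- The word before `1` has length at most `n - 1`; the greatest letters before `1` are determined
by which of the letters `n`, `n - 1`, `n - 2` are among the at most two letters after `1`. -/
lemma emitted_take_one_iff {n : ℕ} (hn : 6 ≤ n) {w : List ℕ} (hw : w.Perm (idWord n)) :
    emitted^[n - 4] (w.take (w.idxOf 1)) ≠ [] ↔ UnsortedAtOne n w.idxOf := by
  have hnd : w.Nodup := hw.nodup_iff.2 (idWord_nodup n)
  have hmem : ∀ x, x ∈ w ↔ 1 ≤ x ∧ x ≤ n := fun x => hw.mem_iff.trans mem_idWord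
  have hlen : w.length = n := by rw [hw.length_eq]; simp [idWord]
  have hlt : ∀ x, 1 ≤ x → x ≤ n → w.idxOf x < n := fun x h1 h2 =>
    hlen ▸ List.idxOf_lt_length_iff.2 ((hmem x).2 ⟨h1, h2⟩)
  have hinj : ∀ x y, 1 ≤ x → x ≤ n → x ≠ y → w.idxOf x ≠ w.idxOf y := fun x y h1 h2 h h' =>
    h ((List.idxOf_inj ((hmem x).2 ⟨h1, h2⟩)).1 h')
  have h1w : 1 ∈ w := (hmem 1).2 (by omega)
  obtain ⟨hQn, hQl, -⟩ := take_idxOf_facts hnd h1w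
  have hp1 := hlt 1 le_rfl (by omega)
  have l₀ := hlt n (by omega) (by omega)
  have l₁ := hlt (n - 1) (by omega) (by omega)
  have l₂ := hlt (n - 2) (by omega) (by omega)
  have l₃ := hlt (n - 3) (by omega) (by omega)
  have l₄ := hlt (n - 4) (by omega) (by omega)
  have d₀ := hinj 1 n (by omega) (by omega) (by omega)
  have d₁ := hinj 1 (n - 1) (by omega) (by omega) (by omega)
  have d₂ := hinj 1 (n - 2) (by omega) (by omega) (by omega)
  have d₃ := hinj 1 (n - 3) (by omega) (by omega) (by omega)
  have d₄ := hinj 1 (n - 4) (by omega) (by omega) (by omega)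
  have i₀₁ := hinj n (n - 1) (by omega) (by omega) (by omega)
  have i₀₂ := hinj n (n - 2) (by omega) (by omega) (by omega)
  have i₀₃ := hinj n (n - 3) (by omega) (by omega) (by omega)
  have i₁₂ := hinj (n - 1) (n - 2) (by omega) (by omega) (by omega)
  have i₁₃ := hinj (n - 1) (n - 3) (by omega) (by omega) (by omega)
  have i₂₃ := hinj (n - 2) (n - 3) (by omega) (by omega) (by omega)
  have hle : ∀ x ∈ w, x ≤ n := fun x hx => ((hmem x).1 hx).2
  by_cases c1 : w.idxOf 1 = n - 1
  · rw [emitted_iterate_take_ne_nil_iff₂ (t₁ := n) (t₂ := n - 1) (t₃ := n - 2) (t₄ := n - 3)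
      (t₅ := n - 4) hnd h1w (by omega) (by omega) (by omega) (by omega) (by omega) (by omega)
      (by omega) (by omega) (by omega) (by omega) (by omega)
      (fun x hx _ => by have := hle x hx; omega)]
    unfold UnsortedAtOne
    beta_reduce
    constructor
    · exact fun h => Or.inl ⟨c1, h⟩
    · rintro (h | h | h | h)
      · exact h.2
      all_goals omega
  by_cases c2 : w.idxOf 1 = n - 2
  · -- the three greatest letters before `1` depend on the letter after it
    have hne : ∀ y x, w.idxOf y = n - 1 → w.idxOf x < w.idxOf 1 → x ≠ y := by
      rintro y x h h' rfl; omega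
    by_cases a₀ : w.idxOf n = n - 1
    · rw [emitted_iterate_take_ne_nil_iff₁ (t₁ := n - 1) (t₂ := n - 2) (t₃ := n - 3)
        hnd h1w (by omega) (by omega) (by omega) (by omega) (by omega) (by omega) (by omega)
        (fun x hx h => by have := hle x hx; have := hne _ _ a₀ h; omega)]
      unfold UnsortedAtOne
      grind
    by_cases a₁ : w.idxOf (n - 1) = n - 1
    · rw [emitted_iterate_take_ne_nil_iff₁ (t₁ := n) (t₂ := n - 2) (t₃ := n - 3)
        hnd h1w (by omega) (by omega) (by omega) (by omega) (by omega) (by omega) (by omega)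
        (fun x hx h => by have := hle x hx; have := hne _ _ a₁ h; omega)]
      unfold UnsortedAtOne
      grind
    by_cases a₂ : w.idxOf (n - 2) = n - 1
    · rw [emitted_iterate_take_ne_nil_iff₁ (t₁ := n) (t₂ := n - 1) (t₃ := n - 3)
        hnd h1w (by omega) (by omega) (by omega) (by omega) (by omega) (by omega) (by omega)
        (fun x hx h => by have := hle x hx; have := hne _ _ a₂ h; omega)]
      unfold UnsortedAtOne
      grind
    · rw [emitted_iterate_take_ne_nil_iff₁ (t₁ := n) (t₂ := n - 1) (t₃ := n - 2)
        hnd h1w (by omega) (by omega) (by omega) (by omega) (by omega) (by omega) (by omega)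
        (fun x hx h => by have := hle x hx; omega)]
      unfold UnsortedAtOne
      grind
  by_cases c3 : w.idxOf 1 = n - 3
  · have hlast : w.idxOf n < n - 3 ∨ w.idxOf (n - 1) < n - 3 ∨ w.idxOf (n - 2) < n - 3 := by omega
    have hne : ∀ y x, n - 3 ≤ w.idxOf y → w.idxOf x < w.idxOf 1 → x ≠ y := by
      rintro y x h h' rfl; omega
    by_cases a₀ : w.idxOf n < n - 3
    · rw [emitted_iterate_take_ne_nil_iff₀ (u := n) hnd h1w (by omega) (by omega)
        (fun x hx h => hle x hx)]
      unfold UnsortedAtOne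
      grind
    have a₀' := fun x => hne n x (by omega)
    by_cases a₁ : w.idxOf (n - 1) < n - 3
    · rw [emitted_iterate_take_ne_nil_iff₀ (u := n - 1) hnd h1w (by omega) (by omega)
        (fun x hx h => by have := hle x hx; have := a₀' x h; omega)]
      unfold UnsortedAtOne
      grind
    have a₁' := fun x => hne (n - 1) x (by omega)
    · rw [emitted_iterate_take_ne_nil_iff₀ (u := n - 2) hnd h1w (by omega) (by omega)
        (fun x hx h => by
          have := hle x hx; have := a₀' x h; have := a₁' x h; omega)]
      unfold UnsortedAtOne
      grind
  · have h := emitted_iterate_eq_nil (k := n - 4) hQn (by omega)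
    unfold UnsortedAtOne
    simp only [h, ne_eq, not_true, false_iff]
    grind

lemma emitted_take_two_iff {n : ℕ} (hn : 6 ≤ n) {v : List ℕ} (hnd : v.Nodup)
    (hmem : ∀ x, x ∈ v ↔ 2 ≤ x ∧ x ≤ n) (hlen : v.length = n - 1) :
    emitted^[n - 4] (v.take (v.idxOf 2)) ≠ [] ↔ UnsortedAtTwo n v.idxOf := by
  have hlt : ∀ x, 2 ≤ x → x ≤ n → v.idxOf x < n - 1 := fun x h1 h2 =>
    hlen ▸ List.idxOf_lt_length_iff.2 ((hmem x).2 ⟨h1, h2⟩)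
  have hinj : ∀ x y, 2 ≤ x → x ≤ n → x ≠ y → v.idxOf x ≠ v.idxOf y := fun x y h1 h2 h h' =>
    h ((List.idxOf_inj ((hmem x).2 ⟨h1, h2⟩)).1 h')
  have h2v : 2 ∈ v := (hmem 2).2 (by omega)
  obtain ⟨hQn, hQl, -⟩ := take_idxOf_facts hnd h2v
  have hp1 := hlt 2 le_rfl (by omega)
  have l₀ := hlt n (by omega) (by omega)
  have l₁ := hlt (n - 1) (by omega) (by omega)
  have l₂ := hlt (n - 2) (by omega) (by omega)
  have d₀ := hinj 2 n (by omega) (by omega) (by omega)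
  have d₁ := hinj 2 (n - 1) (by omega) (by omega) (by omega)
  have d₂ := hinj 2 (n - 2) (by omega) (by omega) (by omega)
  have i₀₁ := hinj n (n - 1) (by omega) (by omega) (by omega)
  have hle : ∀ x ∈ v, x ≤ n := fun x hx => ((hmem x).1 hx).2
  by_cases c1 : v.idxOf 2 = n - 2
  · rw [emitted_iterate_take_ne_nil_iff₁ (t₁ := n) (t₂ := n - 1) (t₃ := n - 2)
      hnd h2v (by omega) (by omega) (by omega) (by omega) (by omega) (by omega) (by omega)
      (fun x hx h => by have := hle x hx; omega)]
    unfold UnsortedAtTwo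
    grind
  by_cases c2 : v.idxOf 2 = n - 3
  · by_cases a₀ : v.idxOf n < n - 3
    · rw [emitted_iterate_take_ne_nil_iff₀ (u := n) hnd h2v (by omega) (by omega)
        (fun x hx h => hle x hx)]
      unfold UnsortedAtTwo
      grind
    · have hne : ∀ x, v.idxOf x < v.idxOf 2 → x ≠ n := by
        rintro x h rfl; omega
      rw [emitted_iterate_take_ne_nil_iff₀ (u := n - 1) hnd h2v (by omega) (by omega)
        (fun x hx h => by have := hle x hx; have := hne x h; omega)]
      unfold UnsortedAtTwo
      grind
  · have h := emitted_iterate_eq_nil (k := n - 4) hQn (by omega)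
    unfold UnsortedAtTwo
    simp only [h, ne_eq, not_true, false_iff]
    grind

lemma emitted_take_three_iff {n : ℕ} (hn : 6 ≤ n) {v : List ℕ} (hnd : v.Nodup)
    (hmem : ∀ x, x ∈ v ↔ 3 ≤ x ∧ x ≤ n) (hlen : v.length = n - 2) :
    emitted^[n - 4] (v.take (v.idxOf 3)) ≠ [] ↔ v.idxOf 3 = n - 3 ∧ v.idxOf n = n - 4 := by
  have hlt : ∀ x, 3 ≤ x → x ≤ n → v.idxOf x < n - 2 := fun x h1 h2 =>
    hlen ▸ List.idxOf_lt_length_iff.2 ((hmem x).2 ⟨h1, h2⟩)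
  have h3v : 3 ∈ v := (hmem 3).2 (by omega)
  obtain ⟨hQn, hQl, -⟩ := take_idxOf_facts hnd h3v
  have l₀ := hlt n (by omega) (by omega)
  have d₀ : v.idxOf 3 ≠ v.idxOf n := fun h => by
    have := (List.idxOf_inj h3v).1 h; omega
  have l₃ := hlt 3 le_rfl (by omega)
  by_cases c1 : v.idxOf 3 = n - 3
  · rw [emitted_iterate_take_ne_nil_iff₀ (u := n) hnd h3v (by omega) (by omega)
      (fun x hx h => ((hmem x).1 hx).2)]
    simp [c1]
  · simp [emitted_iterate_eq_nil (k := n - 4) hQn (by omega), c1]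

/-- The position of `x` after the letter `y` has been deleted. -/
def erasedPos (p : ℕ → ℕ) (y x : ℕ) : ℕ := if p y < p x then p x - 1 else p x

/-- The letters `2` and `3` are treated like `1`, in the words from which the smaller letters have
been deleted. -/
lemma not_sorted_iff_positions {n : ℕ} (hn : 6 ≤ n) {w : List ℕ} (hw : w.Perm (idWord n)) :
    stackSort^[n - 4] w ≠ idWord n ↔ UnsortedAtOne n w.idxOf ∨
      UnsortedAtTwo n (erasedPos w.idxOf 1) ∨
      (erasedPos (erasedPos w.idxOf 1) 2 3 = n - 3 ∧
        erasedPos (erasedPos w.idxOf 1) 2 n = n - 4) := by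
  have hnd : w.Nodup := hw.nodup_iff.2 (idWord_nodup n)
  have hmem : ∀ x, x ∈ w ↔ 1 ≤ x ∧ x ≤ n := fun x => hw.mem_iff.trans mem_idWord
  have hlen : w.length = n := by rw [hw.length_eq]; simp [idWord]
  have hnd' := hnd.erase 1
  have hmem' : ∀ x, x ∈ w.erase 1 ↔ 2 ≤ x ∧ x ≤ n := fun x => by
    rw [hnd.mem_erase_iff, hmem]; omega
  have hlen' : (w.erase 1).length = n - 1 := by
    rw [List.length_erase_of_mem ((hmem 1).2 (by omega)), hlen]
  have hmem'' : ∀ x, x ∈ (w.erase 1).erase 2 ↔ 3 ≤ x ∧ x ≤ n := fun x => by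
    rw [hnd'.mem_erase_iff, hmem']; omega
  have hlen'' : ((w.erase 1).erase 2).length = n - 2 := by
    rw [List.length_erase_of_mem ((hmem' 2).2 (by omega)), hlen']; rfl
  have p₁ : ∀ x, 2 ≤ x → (w.erase 1).idxOf x = erasedPos w.idxOf 1 x := fun x hx =>
    idxOf_erase hnd (by omega)
  have p₂ : ∀ x, 3 ≤ x → ((w.erase 1).erase 2).idxOf x =
      erasedPos (erasedPos w.idxOf 1) 2 x := fun x hx => by
    rw [idxOf_erase hnd' (by omega), p₁ x (by omega), p₁ 2 le_rfl]
    rfl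
  rw [not_sorted_iff hn hw, emitted_take_one_iff hn hw, emitted_take_two_iff hn hnd' hmem' hlen',
    emitted_take_three_iff hn (hnd'.erase 2) hmem'' hlen'', p₂ 3 le_rfl, p₂ n (by omega)]
  unfold UnsortedAtTwo
  beta_reduce
  rw [p₁ 2 le_rfl, p₁ n (by omega), p₁ (n - 1) (by omega), p₁ (n - 2) (by omega)]

/-! ### Glob patterns in terms of positions of letters -/

lemma drop_mem_glob_nil {w : List ℕ} {i : ℕ} : w.drop i ∈ glob [] ↔ w.length ≤ i := by
  simp [glob]

lemma drop_mem_glob_any {w : List ℕ} {i : ℕ} {p : List GlobSymbol} :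
    w.drop i ∈ glob (.any :: p) ↔ i < w.length ∧ w.drop (i + 1) ∈ glob p := by
  simp only [glob, Set.mem_ofPred_eq]
  constructor
  · rintro ⟨a, v, hv, h⟩
    have hi : i < w.length := by
      by_contra hi
      rw [List.drop_eq_nil_of_le (by omega)] at h
      simp at h
    rw [List.drop_eq_getElem_cons hi] at h
    exact ⟨hi, (List.cons.inj h).2 ▸ hv⟩
  · rintro ⟨hi, h⟩
    exact ⟨w[i], _, h, List.drop_eq_getElem_cons hi⟩

lemma drop_mem_glob_lit {w : List ℕ} (hw : w.Nodup) {i a : ℕ} {p : List GlobSymbol} :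
    w.drop i ∈ glob (.lit a :: p) ↔
      i < w.length ∧ w.idxOf a = i ∧ w.drop (i + 1) ∈ glob p := by
  simp only [glob, Set.mem_ofPred_eq]
  constructor
  · rintro ⟨v, hv, h⟩
    have hi : i < w.length := by
      by_contra hi
      rw [List.drop_eq_nil_of_le (by omega)] at h
      simp at h
    rw [List.drop_eq_getElem_cons hi] at h
    obtain ⟨rfl, rfl⟩ := List.cons.inj h
    exact ⟨hi, hw.idxOf_getElem i hi, hv⟩
  · rintro ⟨hi, rfl, h⟩
    refine ⟨_, h, ?_⟩
    conv_lhs => rw [List.drop_eq_getElem_cons hi]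
    rw [List.getElem_idxOf]

lemma drop_mem_glob_star_lit {w : List ℕ} (hw : w.Nodup) {i a : ℕ} {p : List GlobSymbol} :
    w.drop i ∈ glob (.star :: .lit a :: p) ↔
      i ≤ w.idxOf a ∧ w.idxOf a < w.length ∧ w.drop (w.idxOf a + 1) ∈ glob p := by
  have h : w.drop i ∈ glob (.star :: .lit a :: p) ↔
      ∃ j, i ≤ j ∧ w.drop j ∈ glob (.lit a :: p) := by
    rw [glob, Set.mem_ofPred_eq]
    constructor
    · rintro ⟨u, v, hv, h⟩
      refine ⟨i + u.length, by omega, ?_⟩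
      rwa [← List.drop_drop, h, List.drop_left]
    · rintro ⟨j, hj, h⟩
      refine ⟨(w.drop i).take (j - i), w.drop j, h, ?_⟩
      conv_lhs => rw [← List.take_append_drop (j - i) (w.drop i), List.drop_drop]
      rw [Nat.add_sub_cancel' hj]
  rw [h]
  constructor
  · rintro ⟨j, hj, h⟩
    obtain ⟨h1, rfl, h2⟩ := (drop_mem_glob_lit hw).1 h
    exact ⟨hj, h1, h2⟩
  · rintro ⟨h1, h2, h3⟩
    exact ⟨_, h1, (drop_mem_glob_lit hw).2 ⟨h2, rfl, h3⟩⟩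

lemma mem_glob_star_lit {w : List ℕ} (hw : w.Nodup) {a : ℕ} {p : List GlobSymbol} :
    w ∈ glob (.star :: .lit a :: p) ↔
      w.idxOf a < w.length ∧ w.drop (w.idxOf a + 1) ∈ glob p := by
  have h := drop_mem_glob_star_lit hw (i := 0) (a := a) (p := p)
  simpa using h

/-- The pattern `* n A (n-2) B (n-1) 2` with `A` and `B` not both empty, in terms of positions. -/
lemma exists_gap_pattern_iff {n : ℕ} {w : List ℕ} (hw : w.Nodup) :
    (∃ u A B : List ℕ, (A ≠ [] ∨ B ≠ []) ∧
      w = u ++ [n] ++ A ++ [n - 2] ++ B ++ [n - 1, 2]) ↔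
    w ∈ glob [.star, .lit n, .star, .lit (n - 2), .star, .lit (n - 1), .lit 2] ∧
      ¬ w ∈ glob [.star, .lit n, .lit (n - 2), .lit (n - 1), .lit 2] := by
  constructor
  · rintro ⟨u, A, B, hAB, rfl⟩
    refine ⟨?_, ?_⟩
    · simp only [glob, Set.mem_ofPred_eq]
      exact ⟨u, _, ⟨_, ⟨A, _, ⟨_, ⟨B, _, ⟨_, ⟨_, rfl, rfl⟩, rfl⟩, rfl⟩, rfl⟩, rfl⟩, rfl⟩,
        by simp⟩
    · simp only [glob, Set.mem_ofPred_eq]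
      rintro ⟨u', _, ⟨_, ⟨_, ⟨_, ⟨_, rfl, rfl⟩, rfl⟩, rfl⟩, rfl⟩, h⟩
      have h1 : (u ++ [n] ++ A ++ [n - 2] ++ B ++ [n - 1, 2]).idxOf n = u.length := by
        have e : u ++ [n] ++ A ++ [n - 2] ++ B ++ [n - 1, 2] =
          u ++ n :: (A ++ [n - 2] ++ B ++ [n - 1, 2]) := by simp
        rw [e] at hw ⊢
        exact idxOf_append_cons_self hw
      have h2 : (u ++ [n] ++ A ++ [n - 2] ++ B ++ [n - 1, 2]).idxOf n = u'.length := by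
        rw [h] at hw ⊢
        exact idxOf_append_cons_self hw
      have h3 := congrArg List.length h
      simp only [List.length_append, List.length_cons, List.length_nil] at h3
      have hA : A = [] := List.length_eq_zero_iff.1 (by omega)
      have hB : B = [] := List.length_eq_zero_iff.1 (by omega)
      simp [hA, hB] at hAB
  · simp only [glob, Set.mem_ofPred_eq]
    rintro ⟨⟨u, _, ⟨_, ⟨A, _, ⟨_, ⟨B, _, ⟨_, ⟨_, rfl, rfl⟩, rfl⟩, rfl⟩, rfl⟩, rfl⟩, rfl⟩, rfl⟩, h⟩
    refine ⟨u, A, B, ?_, by simp⟩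
    by_contra hAB
    push Not at hAB
    obtain ⟨rfl, rfl⟩ := hAB
    exact h ⟨u, _, ⟨_, ⟨_, ⟨_, ⟨_, rfl, rfl⟩, rfl⟩, rfl⟩, rfl⟩, by simp⟩

lemma mem_globs_cons {q : List GlobSymbol} {qs : List (List GlobSymbol)} {w : List ℕ} :
    w ∈ globs (q :: qs) ↔ w ∈ glob q ∨ w ∈ globs qs := by
  simp [globs]

lemma not_mem_globs_nil {w : List ℕ} : ¬ w ∈ globs [] := by
  simp [globs]

/-! ### Classification of the unsorted permutations by positions of letters -/

/-- The bounds and inequalities satisfied by the positions `a`, `b`, `c`, `d`, `e`, `x`, `y`, `z` of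
the letters `n`, `n - 1`, `n - 2`, `n - 3`, `n - 4`, `1`, `2`, `3` in a permutation of `1, …, n`.
For `n = 6` and `n = 7` some of these letters coincide, so the list does not separate `y` and `z`
from `d` and `e`. -/
structure LetterPositions (n a b c d e x y z : ℕ) : Prop where
  la : a < n
  lb : b < n
  lc : c < n
  ld : d < n
  le : e < n
  lx : x < n
  ly : y < n
  lz : z < n
  ab : a ≠ b
  ac : a ≠ c
  ad : a ≠ d
  ae : a ≠ e
  bc : b ≠ c
  bd : b ≠ d
  be : b ≠ e
  cd : c ≠ d
  ce : c ≠ e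
  de : d ≠ e
  ax : a ≠ x
  bx : b ≠ x
  cx : c ≠ x
  dx : d ≠ x
  ex : e ≠ x
  ay : a ≠ y
  yb : b ≠ y
  cy : c ≠ y
  az : a ≠ z
  bz : b ≠ z
  cz : c ≠ z
  xy : x ≠ y
  xz : x ≠ z
  yz : y ≠ z

lemma letterPositions {n : ℕ} (hn : 6 ≤ n) {w : List ℕ} (hw : w.Perm (idWord n)) :
    LetterPositions n (w.idxOf n) (w.idxOf (n - 1)) (w.idxOf (n - 2)) (w.idxOf (n - 3))
      (w.idxOf (n - 4)) (w.idxOf 1) (w.idxOf 2) (w.idxOf 3) := by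
  have hmem : ∀ x, x ∈ w ↔ 1 ≤ x ∧ x ≤ n := fun x => hw.mem_iff.trans mem_idWord
  have hlen : w.length = n := by rw [hw.length_eq]; simp [idWord]
  have hlt : ∀ x, 1 ≤ x ∧ x ≤ n → w.idxOf x < n := fun x h =>
    lt_of_lt_of_eq (List.idxOf_lt_length_iff.2 ((hmem x).2 h)) hlen
  have hinj : ∀ x y, (1 ≤ x ∧ x ≤ n) ∧ x ≠ y → w.idxOf x ≠ w.idxOf y := fun x y h h' =>
    h.2 ((List.idxOf_inj ((hmem x).2 h.1)).1 h')
  constructor <;> first | exact hlt _ (by omega) | exact hinj _ _ (by omega)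

/-- The permutations that `n - 4` passes do not sort, in terms of the positions `a`, `b`, `c`, `d`,
`e`, `x`, `y`, `z` of the letters `n`, `n - 1`, `n - 2`, `n - 3`, `n - 4`, `1`, `2`, `3`, counted
from zero. In the first four groups `n` is the last letter, or has one, two, or three letters to its
right; in the other cases only its order relative to other letters is prescribed. For the positions
of letters in a permutation the cases are mutually exclusive, so their numbers can be added up. -/
def BadPositions (n a b c d e x y z : ℕ) : Prop :=
  (a = n - 1 ∧ ((b = n - 3 ∧ x = n - 2) ∨ (b = n - 3 ∧ y = n - 2) ∨
    (c = n - 4 ∧ x = n - 3 ∧ b = n - 2) ∨ (b = n - 4 ∧ x = n - 3) ∨ (b = n - 4 ∧ x = n - 2) ∨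
    (c = n - 3 ∧ x = n - 2 ∧ b < d))) ∨
  (a = n - 2 ∧ (x = n - 1 ∨ y = n - 1 ∨ z = n - 1 ∨
    (b = n - 4 ∧ x = n - 3 ∧ y ≠ n - 1 ∧ z ≠ n - 1) ∨ (c = n - 4 ∧ x = n - 3 ∧ b = n - 1))) ∨
  (a = n - 3 ∧ (x = n - 2 ∨ x = n - 1 ∨ (y = n - 2 ∧ x ≠ n - 1) ∨ (y = n - 1 ∧ x ≠ n - 2))) ∨
  (a = n - 4 ∧ (x = n - 3 ∨ x = n - 2 ∨ (x = n - 1 ∧ ¬ (c = n - 3 ∧ b = n - 2)))) ∨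
  (b = n - 2 ∧ y = n - 1 ∧ a < c) ∨ (b = n - 2 ∧ x = n - 1 ∧ a < c) ∨
  (b = n - 3 ∧ c = n - 2 ∧ x = n - 1 ∧ a < d) ∨ (c = n - 2 ∧ x = n - 1 ∧ a < b ∧ b < d) ∨
  (c = n - 2 ∧ x = n - 1 ∧ b < a ∧ a < d ∧ d < e) ∨
  (c = n - 2 ∧ x = n - 1 ∧ b < a ∧ a < e ∧ e < d) ∨
  (b = n - 3 ∧ x = n - 2 ∧ a < c ∧ c ≠ n - 1) ∨ (b = n - 3 ∧ x = n - 1 ∧ a < c ∧ c ≠ n - 2) ∨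
  (b = n - 3 ∧ x = n - 2 ∧ c = n - 1 ∧ a < d) ∨ (c = n - 3 ∧ x = n - 2 ∧ b = n - 1 ∧ a < d) ∨
  (b = n - 2 ∧ x = n - 1 ∧ c < a ∧ a < d ∧ d < e) ∨
  (b = n - 2 ∧ x = n - 1 ∧ c < a ∧ a < e ∧ e < d)

lemma badPositions_of_unsortedAtOne {n : ℕ} (hn : 6 ≤ n) {p : ℕ → ℕ}
    (h : LetterPositions n (p n) (p (n - 1)) (p (n - 2)) (p (n - 3)) (p (n - 4)) (p 1) (p 2) (p 3))
    (hu : UnsortedAtOne n p) :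
    BadPositions n (p n) (p (n - 1)) (p (n - 2)) (p (n - 3)) (p (n - 4)) (p 1) (p 2) (p 3) := by
  unfold UnsortedAtOne SurvivalPositions at hu
  generalize p n = a, p (n - 1) = b, p (n - 2) = c, p (n - 3) = d, p (n - 4) = e, p 1 = x,
    p 2 = y, p 3 = z at *
  obtain ⟨la, lb, lc, ld, le, lx, ly, lz, ab, ac, ad, ae, bc, bd, be, cd, ce, de, ax, bx, cx, dx,
    ex, ay, yb, cy, az, bz, cz, xy, xz, yz⟩ := h
  unfold BadPositions
  rcases hu with ⟨h0, h | h | h | h | h | h | h⟩ | ⟨h0, h1, h | h | h⟩ |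
    ⟨h0, h1, h | h | h | h | h⟩ | ⟨h0, h | ⟨h1, h | h⟩⟩ <;> grind (splits := 40)

lemma erasedPos_cases (p : ℕ → ℕ) (y x : ℕ) :
    (p y < p x ∧ erasedPos p y x = p x - 1) ∨ (p x ≤ p y ∧ erasedPos p y x = p x) := by
  unfold erasedPos
  split_ifs <;> omega

/-- Inversion of the shift `v ↦ v'` of positions that deleting the position `x` causes. -/
lemma shift_eq_iff {x v v' k : ℕ} (h : (x < v ∧ v' = v - 1) ∨ (v ≤ x ∧ v' = v)) (hv : x ≠ v) :
    v' = k ↔ (v = k + 1 ∧ x ≤ k) ∨ (v = k ∧ k < x) := by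
  omega

lemma badPositions_of_unsortedAtTwo {n : ℕ} (hn : 6 ≤ n) {p : ℕ → ℕ}
    (h : LetterPositions n (p n) (p (n - 1)) (p (n - 2)) (p (n - 3)) (p (n - 4)) (p 1) (p 2) (p 3))
    (hu : UnsortedAtTwo n (erasedPos p 1)) :
    BadPositions n (p n) (p (n - 1)) (p (n - 2)) (p (n - 3)) (p (n - 4)) (p 1) (p 2) (p 3) := by
  have q₀ := erasedPos_cases p 1 n
  have q₁ := erasedPos_cases p 1 (n - 1)
  have q₂ := erasedPos_cases p 1 (n - 2)
  have q₃ := erasedPos_cases p 1 2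
  unfold UnsortedAtTwo at hu
  generalize erasedPos p 1 n = a', erasedPos p 1 (n - 1) = b', erasedPos p 1 (n - 2) = c',
    erasedPos p 1 2 = y' at *
  generalize p n = a, p (n - 1) = b, p (n - 2) = c, p (n - 3) = d, p (n - 4) = e, p 1 = x,
    p 2 = y, p 3 = z at *
  obtain ⟨la, lb, lc, ld, le, lx, ly, lz, ab, ac, ad, ae, bc, bd, be, cd, ce, de, ax, bx, cx, dx,
    ex, ay, yb, cy, az, bz, cz, xy, xz, yz⟩ := h
  -- the cases of `BadPositions` that can arise here
  have key :
    (a = n - 2 ∧ y = n - 1) ∨ (a = n - 3 ∧ x = n - 2) ∨ (a = n - 3 ∧ x = n - 1) ∨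
      (a = n - 3 ∧ y = n - 2 ∧ x ≠ n - 1) ∨ (a = n - 3 ∧ y = n - 1 ∧ x ≠ n - 2) ∨
      (a = n - 4 ∧ x = n - 3) ∨ (a = n - 4 ∧ x = n - 2) ∨ (a = n - 4 ∧ x = n - 1 ∧ n - 3 ≤ y) ∨
      (b = n - 2 ∧ y = n - 1 ∧ a < c) ∨ (b = n - 3 ∧ x = n - 2 ∧ a < c ∧ c ≠ n - 1) ∨
      (b = n - 3 ∧ x = n - 1 ∧ a < c ∧ c ≠ n - 2) ∨ (a = n - 2 ∧ x = n - 1) ∨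
      (a = n - 1 ∧ b = n - 4 ∧ x = n - 2) ∨ (a = n - 1 ∧ b = n - 4 ∧ x = n - 3) ∨
      (a = n - 1 ∧ b = n - 3 ∧ y = n - 2) := by
    clear ld le lz ad ae bd be cd ce de dx ex az bz cz xz yz lb lc la ly
    rw [shift_eq_iff q₃ xy] at hu
    rw [shift_eq_iff q₃ xy] at hu
    simp only [shift_eq_iff q₀ ax.symm, shift_eq_iff q₁ bx.symm] at hu
    rcases hu with ⟨h0 | h0, (h | h) | (h | h) | ⟨h | h, h'⟩⟩ |
      ⟨h0 | h0, (h | h) | ⟨h | h, h' | h'⟩⟩ <;> clear q₃ <;> grind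
  rcases key with h | h | h | h | h | h | h | h | h | h | h | h | h | h | h
  · exact Or.inr (Or.inl ⟨h.1, Or.inr (Or.inl h.2)⟩)
  · exact Or.inr (Or.inr (Or.inl ⟨h.1, Or.inl h.2⟩))
  · exact Or.inr (Or.inr (Or.inl ⟨h.1, Or.inr (Or.inl h.2)⟩))
  · exact Or.inr (Or.inr (Or.inl ⟨h.1, Or.inr (Or.inr (Or.inl h.2))⟩))
  · exact Or.inr (Or.inr (Or.inl ⟨h.1, Or.inr (Or.inr (Or.inr (h.2)))⟩))
  · exact Or.inr (Or.inr (Or.inr (Or.inl ⟨h.1, Or.inl h.2⟩)))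
  · exact Or.inr (Or.inr (Or.inr (Or.inl ⟨h.1, Or.inr (Or.inl h.2)⟩)))
  · exact Or.inr (Or.inr (Or.inr (Or.inl ⟨h.1, Or.inr (Or.inr (⟨h.2.1, by omega⟩))⟩)))
  · exact Or.inr (Or.inr (Or.inr (Or.inr (Or.inl h))))
  · exact Or.inr (Or.inr (Or.inr (Or.inr (Or.inr (Or.inr (Or.inr (Or.inr (
      Or.inr (Or.inr (Or.inl h))))))))))
  · exact Or.inr (Or.inr (Or.inr (Or.inr (Or.inr (Or.inr (Or.inr (Or.inr (
      Or.inr (Or.inr (Or.inr (Or.inl h)))))))))))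
  · exact Or.inr (Or.inl ⟨h.1, Or.inl h.2⟩)
  · exact Or.inl ⟨h.1, Or.inr (Or.inr (Or.inr (Or.inr (Or.inl h.2))))⟩
  · exact Or.inl ⟨h.1, Or.inr (Or.inr (Or.inr (Or.inl h.2)))⟩
  · exact Or.inl ⟨h.1, Or.inr (Or.inl h.2)⟩

lemma badPositions_of_unsortedAtThree {n : ℕ} (hn : 6 ≤ n) {p : ℕ → ℕ}
    (h : LetterPositions n (p n) (p (n - 1)) (p (n - 2)) (p (n - 3)) (p (n - 4)) (p 1) (p 2) (p 3))
    (h₃ : erasedPos (erasedPos p 1) 2 3 = n - 3) (h₀ : erasedPos (erasedPos p 1) 2 n = n - 4) :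
    BadPositions n (p n) (p (n - 1)) (p (n - 2)) (p (n - 3)) (p (n - 4)) (p 1) (p 2) (p 3) := by
  have q₀ := erasedPos_cases p 1 n
  have q₂ := erasedPos_cases p 1 2
  have q₃ := erasedPos_cases p 1 3
  have r₀ := erasedPos_cases (erasedPos p 1) 2 n
  have r₃ := erasedPos_cases (erasedPos p 1) 2 3
  generalize erasedPos (erasedPos p 1) 2 3 = z'', erasedPos (erasedPos p 1) 2 n = a'' at *
  generalize erasedPos p 1 n = a', erasedPos p 1 2 = y', erasedPos p 1 3 = z' at *
  generalize p n = a, p (n - 1) = b, p (n - 2) = c, p (n - 3) = d, p (n - 4) = e, p 1 = x,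
    p 2 = y, p 3 = z at *
  obtain ⟨la, lb, lc, ld, le, lx, ly, lz, ab, ac, ad, ae, bc, bd, be, cd, ce, de, ax, bx, cx, dx,
    ex, ay, yb, cy, az, bz, cz, xy, xz, yz⟩ := h
  -- the cases of `BadPositions` that can arise here
  have key :
    (a = n - 2 ∧ z = n - 1) ∨ (a = n - 3 ∧ x = n - 2) ∨ (a = n - 3 ∧ x = n - 1) ∨
      (a = n - 3 ∧ y = n - 2 ∧ x ≠ n - 1) ∨ (a = n - 3 ∧ y = n - 1 ∧ x ≠ n - 2) ∨
      (a = n - 4 ∧ x = n - 3) ∨ (a = n - 4 ∧ x = n - 2) ∨ (a = n - 4 ∧ x = n - 1 ∧ n - 3 ≤ y) := by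
    clear ld le lb lc ab ac ad ae bc bd be cd ce de bx cx dx ex yb cy bz cz
    have h₂ : y' ≠ a' := by omega
    have h₃' : y' ≠ z' := by omega
    rw [shift_eq_iff r₀ h₂] at h₀
    rw [shift_eq_iff r₃ h₃'] at h₃
    simp only [shift_eq_iff q₀ ax.symm, shift_eq_iff q₃ xz] at h₀ h₃
    rcases h₀ with ⟨h₀ | h₀, h₀'⟩ | ⟨h₀ | h₀, h₀'⟩ <;>
    rcases h₃ with ⟨h₃ | h₃, h₃'⟩ | ⟨h₃ | h₃, h₃'⟩ <;> clear q₀ q₃ r₀ r₃ <;> grind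
  rcases key with h | h | h | h | h | h | h | h
  · exact Or.inr (Or.inl ⟨h.1, Or.inr (Or.inr (Or.inl h.2))⟩)
  · exact Or.inr (Or.inr (Or.inl ⟨h.1, Or.inl h.2⟩))
  · exact Or.inr (Or.inr (Or.inl ⟨h.1, Or.inr (Or.inl h.2)⟩))
  · exact Or.inr (Or.inr (Or.inl ⟨h.1, Or.inr (Or.inr (Or.inl h.2))⟩))
  · exact Or.inr (Or.inr (Or.inl ⟨h.1, Or.inr (Or.inr (Or.inr (h.2)))⟩))
  · exact Or.inr (Or.inr (Or.inr (Or.inl ⟨h.1, Or.inl h.2⟩)))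
  · exact Or.inr (Or.inr (Or.inr (Or.inl ⟨h.1, Or.inr (Or.inl h.2)⟩)))
  · exact Or.inr (Or.inr (Or.inr (Or.inl ⟨h.1, Or.inr (Or.inr (⟨h.2.1, by omega⟩))⟩)))

/-- Configurations in which the letter `2` stays unsorted. By `unsortedAtOne_of_badPositions`, these
and the ones of `unsortedAtThree_of_positions` are all that the letter `1` does not account for. -/
lemma unsortedAtTwo_of_positions {n : ℕ} (hn : 6 ≤ n) {p : ℕ → ℕ}
    (h : LetterPositions n (p n) (p (n - 1)) (p (n - 2)) (p (n - 3)) (p (n - 4)) (p 1) (p 2) (p 3))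
    (hb : (p n = n - 1 ∧ p (n - 1) = n - 3 ∧ p 2 = n - 2) ∨ (p n = n - 2 ∧ p 2 = n - 1) ∨
      (p n = n - 3 ∧ p 2 = n - 2 ∧ p 1 ≠ n - 1) ∨ (p n = n - 3 ∧ p 2 = n - 1 ∧ p 1 ≠ n - 2) ∨
      (p (n - 1) = n - 2 ∧ p 2 = n - 1 ∧ p n < p (n - 2))) :
    UnsortedAtTwo n (erasedPos p 1) := by
  have q₀ : erasedPos p 1 n = if p 1 < p n then p n - 1 else p n := rfl
  have q₂ : erasedPos p 1 2 = if p 1 < p 2 then p 2 - 1 else p 2 := rfl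
  have q₁ : erasedPos p 1 (n - 1) = if p 1 < p (n - 1) then p (n - 1) - 1 else p (n - 1) := rfl
  have q₄ : erasedPos p 1 (n - 2) = if p 1 < p (n - 2) then p (n - 2) - 1 else p (n - 2) := rfl
  unfold UnsortedAtTwo
  generalize erasedPos p 1 n = a', erasedPos p 1 (n - 1) = b', erasedPos p 1 (n - 2) = c',
    erasedPos p 1 2 = y' at *
  generalize p n = a, p (n - 1) = b, p (n - 2) = c, p (n - 3) = d, p (n - 4) = e, p 1 = x,
    p 2 = y, p 3 = z at *
  obtain ⟨la, lb, lc, ld, le, lx, ly, lz, ab, ac, ad, ae, bc, bd, be, cd, ce, de, ax, bx, cx, dx,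
    ex, ay, yb, cy, az, bz, cz, xy, xz, yz⟩ := h
  rcases hb with h | h | h | h | h <;> grind

lemma unsortedAtThree_of_positions {n : ℕ} {p : ℕ → ℕ}
    (h : LetterPositions n (p n) (p (n - 1)) (p (n - 2)) (p (n - 3)) (p (n - 4)) (p 1) (p 2) (p 3))
    (h₀ : p n = n - 2) (h₃ : p 3 = n - 1) :
    erasedPos (erasedPos p 1) 2 3 = n - 3 ∧ erasedPos (erasedPos p 1) 2 n = n - 4 := by
  have q₀ : erasedPos p 1 n = if p 1 < p n then p n - 1 else p n := rfl
  have q₂ : erasedPos p 1 2 = if p 1 < p 2 then p 2 - 1 else p 2 := rfl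
  have q₃ : erasedPos p 1 3 = if p 1 < p 3 then p 3 - 1 else p 3 := rfl
  have r₃ : erasedPos (erasedPos p 1) 2 3 =
    if erasedPos p 1 2 < erasedPos p 1 3 then erasedPos p 1 3 - 1 else erasedPos p 1 3 := rfl
  have r₀ : erasedPos (erasedPos p 1) 2 n =
    if erasedPos p 1 2 < erasedPos p 1 n then erasedPos p 1 n - 1 else erasedPos p 1 n := rfl
  generalize erasedPos (erasedPos p 1) 2 3 = z'', erasedPos (erasedPos p 1) 2 n = a'' at *
  generalize erasedPos p 1 n = a', erasedPos p 1 2 = y', erasedPos p 1 3 = z' at *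
  generalize p n = a, p (n - 1) = b, p (n - 2) = c, p (n - 3) = d, p (n - 4) = e, p 1 = x,
    p 2 = y, p 3 = z at *
  obtain ⟨la, lb, lc, ld, le, lx, ly, lz, ab, ac, ad, ae, bc, bd, be, cd, ce, de, ax, bx, cx, dx,
    ex, ay, yb, cy, az, bz, cz, xy, xz, yz⟩ := h
  grind

lemma unsortedAtOne_of_badPositions {n : ℕ} (hn : 6 ≤ n) {p : ℕ → ℕ}
    (h : LetterPositions n (p n) (p (n - 1)) (p (n - 2)) (p (n - 3)) (p (n - 4)) (p 1) (p 2) (p 3))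
    (hb : BadPositions n (p n) (p (n - 1)) (p (n - 2)) (p (n - 3)) (p (n - 4)) (p 1) (p 2) (p 3)) :
    UnsortedAtOne n p ∨
      ((p n = n - 1 ∧ p (n - 1) = n - 3 ∧ p 2 = n - 2) ∨ (p n = n - 2 ∧ p 2 = n - 1) ∨
      (p n = n - 3 ∧ p 2 = n - 2 ∧ p 1 ≠ n - 1) ∨ (p n = n - 3 ∧ p 2 = n - 1 ∧ p 1 ≠ n - 2) ∨
      (p (n - 1) = n - 2 ∧ p 2 = n - 1 ∧ p n < p (n - 2))) ∨ (p n = n - 2 ∧ p 3 = n - 1) := by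
  unfold UnsortedAtOne SurvivalPositions
  generalize p n = a, p (n - 1) = b, p (n - 2) = c, p (n - 3) = d, p (n - 4) = e, p 1 = x,
    p 2 = y, p 3 = z at *
  obtain ⟨la, lb, lc, ld, le, lx, ly, lz, ab, ac, ad, ae, bc, bd, be, cd, ce, de, ax, bx, cx, dx,
    ex, ay, yb, cy, az, bz, cz, xy, xz, yz⟩ := h
  rcases hb with ⟨h0, h | h | h | h | h | h⟩ | ⟨h0, h | h | h | h | h⟩ | ⟨h0, h | h | h | h⟩ |
    ⟨h0, h | h | h⟩ | h | h | h | h | h | h | h | h | h | h | h | h <;> grind (splits := 40)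

lemma not_sorted_iff_badPositions {n : ℕ} (hn : 6 ≤ n) {w : List ℕ} (hw : w.Perm (idWord n)) :
    stackSort^[n - 4] w ≠ idWord n ↔
      BadPositions n (w.idxOf n) (w.idxOf (n - 1)) (w.idxOf (n - 2)) (w.idxOf (n - 3))
        (w.idxOf (n - 4)) (w.idxOf 1) (w.idxOf 2) (w.idxOf 3) := by
  have h := letterPositions hn hw
  rw [not_sorted_iff_positions hn hw]
  constructor
  · rintro (hu | hu | ⟨h₃, h₀⟩)
    · exact badPositions_of_unsortedAtOne (p := fun v => w.idxOf v) hn h hu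
    · exact badPositions_of_unsortedAtTwo (p := fun v => w.idxOf v) hn h hu
    · exact badPositions_of_unsortedAtThree (p := fun v => w.idxOf v) hn h h₃ h₀
  · intro hb
    rcases unsortedAtOne_of_badPositions (p := fun v => w.idxOf v) hn h hb with hu | hu | hu
    · exact Or.inl hu
    · exact Or.inr (Or.inl (unsortedAtTwo_of_positions (p := fun v => w.idxOf v) hn h hu))
    · exact Or.inr (Or.inr
        (unsortedAtThree_of_positions (p := fun v => w.idxOf v) h hu.1 hu.2))

set_option maxHeartbeats 4000000 in
lemma mem_types_iff_badPositions {n : ℕ} (hn : 6 ≤ n) {w : List ℕ} (hw : w.Perm (idWord n)) :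
    w ∈ typesA n ∪ typesB n ∪ typesC n ↔
      BadPositions n (w.idxOf n) (w.idxOf (n - 1)) (w.idxOf (n - 2)) (w.idxOf (n - 3))
        (w.idxOf (n - 4)) (w.idxOf 1) (w.idxOf 2) (w.idxOf 3) := by
  have hnd : w.Nodup := hw.nodup_iff.2 (idWord_nodup n)
  have hlen : w.length = n := by rw [hw.length_eq]; simp [idWord]
  have h := letterPositions hn hw
  -- every pattern becomes a conjunction of linear conditions on positions
  simp only [typesA, typesB, typesC, Set.mem_union, Set.mem_sdiff, Set.mem_ofPred_eq,
    mem_globs_cons, not_mem_globs_nil, exists_gap_pattern_iff hnd, mem_glob_star_lit hnd,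
    drop_mem_glob_star_lit hnd, drop_mem_glob_lit hnd, drop_mem_glob_any, drop_mem_glob_nil, hlen,
    or_false]
  generalize w.idxOf n = a, w.idxOf (n - 1) = b, w.idxOf (n - 2) = c, w.idxOf (n - 3) = d,
    w.idxOf (n - 4) = e, w.idxOf 1 = x, w.idxOf 2 = y, w.idxOf 3 = z at *
  obtain ⟨la, lb, lc, ld, le, lx, ly, lz, ab, ac, ad, ae, bc, bd, be, cd, ce, de, ax, bx, cx, dx,
    ex, ay, yb, cy, az, bz, cz, xy, xz, yz⟩ := h
  clear hw hnd hlen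
  unfold BadPositions
  constructor
  · intro h
    rcases h with (h | h | h | h | h | h) |
      (((((((h | h | h | h | h) | h | h | h) | h | h) | h) | h | h | h) | h) |
        h | h | h | h | h | h | h | h | h | h)
    all_goals grind (splits := 40)
  · rintro (⟨h0, h | h | h | h | h | h⟩ | ⟨h0, h | h | h | h | h⟩ | ⟨h0, h | h | h | h⟩ |
      ⟨h0, h | h | h⟩ | h | h | h | h | h | h | h | h | h | h | h | h)
    all_goals grind (splits := 40)

/-! ### Counting permutations with prescribed positions of letters -/

lemma card_perm_extending {α : Type*} [Fintype α] [DecidableEq α] {k : ℕ} (f g : Fin k ↪ α) :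
    Nat.card {σ : Equiv.Perm α // ∀ i, σ (f i) = g i} = (Fintype.card α - k).factorial := by
  classical
  let e : {x // x ∈ Set.range f} ≃ {x // x ∈ Set.range g} :=
    (Equiv.ofInjective f f.injective).symm.trans (Equiv.ofInjective g g.injective)
  let τ : Equiv.Perm α := e.extendSubtype
  have hτ : ∀ i, τ (f i) = g i := by
    intro i
    rw [Equiv.extendSubtype_apply_of_mem e (f i) ⟨i, rfl⟩]
    have : (⟨f i, ⟨i, rfl⟩⟩ : {x // x ∈ Set.range f}) = Equiv.ofInjective f f.injective i := rfl
    rw [this]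
    simp [e]
  have e₁ : {σ : Equiv.Perm α // ∀ i, σ (f i) = g i} ≃
      {ρ : Equiv.Perm α // ∀ a, ¬ (a ∉ Set.range f) → ρ a = a} :=
    (Equiv.mulLeft τ⁻¹).subtypeEquiv fun σ => by
      simp only [not_not, Set.forall_mem_range, Equiv.coe_mulLeft, Equiv.Perm.mul_apply,
        Equiv.Perm.inv_eq_iff_eq, hτ]
  rw [Nat.card_congr (e₁.trans (Equiv.Perm.subtypeEquivSubtypePerm (· ∉ Set.range f)).symm),
    Nat.card_perm, Nat.card_eq_fintype_card, Fintype.card_subtype_compl]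
  congr 2
  rw [← Nat.card_eq_fintype_card, ← Nat.card_congr (Equiv.ofInjective f f.injective)]
  simp

/-- The permutations with prescribed values on the range of `f` split into classes of `m !`
elements, by permuting the values on the range of `c`; each class has exactly one element that
is increasing along `c`. -/
lemma card_perm_extending_strictMono {α : Type*} [Fintype α] [LinearOrder α] {k m : ℕ}
    (f g : Fin k ↪ α) (c : Fin m ↪ α) (hfc : ∀ i j, f i ≠ c j) :
    Nat.card {σ : Equiv.Perm α // (∀ i, σ (f i) = g i) ∧ StrictMono (σ ∘ c)} * m.factorial =
      (Fintype.card α - k).factorial := by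
  classical
  rw [← card_perm_extending f g]
  have hm : m.factorial = Nat.card (Equiv.Perm (Fin m)) := by rw [Nat.card_perm, Nat.card_fin]
  rw [hm, ← Nat.card_prod]
  have hf : ∀ (τ : Equiv.Perm (Fin m)) i, τ.viaFintypeEmbedding c (f i) = f i := fun τ i =>
    τ.viaFintypeEmbedding_apply_notMem_range c fun ⟨j, hj⟩ => hfc i j hj.symm
  have hinv : ∀ (τ : Equiv.Perm (Fin m)),
      τ⁻¹.viaFintypeEmbedding c = (τ.viaFintypeEmbedding c)⁻¹ := fun τ => by
    simp [Equiv.Perm.viaFintypeEmbedding, Equiv.Perm.extendDomain_inv]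
  have hc : ∀ (σ : Equiv.Perm α) (τ : Equiv.Perm (Fin m)),
      (σ * τ.viaFintypeEmbedding c) ∘ c = (σ ∘ c) ∘ τ := fun σ τ => by
    ext i
    simp [Equiv.Perm.viaFintypeEmbedding_apply_image]
  refine Nat.card_congr
    { toFun := fun p => ⟨p.1.1 * p.2⁻¹.viaFintypeEmbedding c, fun i => ?_⟩
      invFun := fun q =>
        (⟨q.1 * (Tuple.sort (q.1 ∘ c)).viaFintypeEmbedding c, fun i => ?_, ?_⟩,
          Tuple.sort (q.1 ∘ c))
      left_inv := ?_
      right_inv := ?_ }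
  · rw [Equiv.Perm.mul_apply, hf, p.1.2.1 i]
  · rw [Equiv.Perm.mul_apply, hf, q.2 i]
  · rw [hc]
    exact (Tuple.monotone_sort (q.1 ∘ c)).strictMono_of_injective
      ((q.1.injective.comp c.injective).comp (Equiv.injective _))
  · rintro ⟨⟨p, hp, hmono⟩, τ⟩
    have hs : Tuple.sort ((p * τ⁻¹.viaFintypeEmbedding c) ∘ c) = τ := by
      symm
      rw [Tuple.eq_sort_iff, hc]
      have h : ((p ∘ c) ∘ (τ⁻¹ : Equiv.Perm (Fin m))) ∘ τ = p ∘ c := by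
        ext i
        simp
      refine ⟨by rw [h]; exact hmono.monotone, fun i j hij h' => absurd ?_ hij.ne⟩
      exact τ.injective (((p.injective.comp c.injective).comp (Equiv.injective τ⁻¹)) h')
    simp only [Prod.mk.injEq, Subtype.mk.injEq]
    refine ⟨?_, hs⟩
    rw [hs, hinv, inv_mul_cancel_right]
  · rintro ⟨q, hq⟩
    simp only [Subtype.mk.injEq]
    rw [hinv, mul_inv_cancel_right]

/-- The word of length `n` in which the letter `i + 1` has the position `σ i`. -/
def wordOfPositions {n : ℕ} (σ : Equiv.Perm (Fin n)) : List ℕ :=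
  List.ofFn fun j => (σ.symm j : ℕ) + 1

lemma wordOfPositions_nodup {n : ℕ} (σ : Equiv.Perm (Fin n)) : (wordOfPositions σ).Nodup := by
  refine List.nodup_ofFn.2 fun i j h => ?_
  simpa [Fin.val_inj] using h

lemma wordOfPositions_perm {n : ℕ} (σ : Equiv.Perm (Fin n)) :
    (wordOfPositions σ).Perm (idWord n) := by
  rw [List.perm_ext_iff_of_nodup (wordOfPositions_nodup σ) (idWord_nodup n)]
  intro v
  rw [mem_idWord, wordOfPositions, List.mem_ofFn]
  constructor
  · rintro ⟨j, rfl⟩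
    have := (σ.symm j).isLt
    omega
  · rintro ⟨h₁, h₂⟩
    exact ⟨σ ⟨v - 1, by omega⟩, by simp; omega⟩

lemma idxOf_wordOfPositions {n : ℕ} (σ : Equiv.Perm (Fin n)) (i : Fin n) :
    (wordOfPositions σ).idxOf ((i : ℕ) + 1) = σ i := by
  have h := (wordOfPositions_nodup σ).idxOf_getElem (σ i) (by simp [wordOfPositions])
  have h' : (wordOfPositions σ)[(σ i : ℕ)]'(by simp [wordOfPositions]) = (i : ℕ) + 1 := by
    simp [wordOfPositions]
  rwa [h'] at h

lemma bijOn_wordOfPositions (n : ℕ) :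
    Set.BijOn (wordOfPositions (n := n)) Set.univ (permWords n) := by
  refine ⟨fun σ _ => wordOfPositions_perm σ, fun σ _ τ _ h => ?_, fun w hw => ?_⟩
  · ext i
    rw [← idxOf_wordOfPositions σ, ← idxOf_wordOfPositions τ, h]
  · have hw' : w.Perm (idWord n) := hw
    have hlen : w.length = n := by rw [hw'.length_eq]; simp [idWord]
    have hmem : ∀ i : Fin n, (i : ℕ) + 1 ∈ w := fun i =>
      hw'.mem_iff.2 (mem_idWord.2 ⟨by omega, i.isLt⟩)
    let p : Fin n → Fin n := fun i =>
      ⟨w.idxOf ((i : ℕ) + 1), lt_of_lt_of_eq (List.idxOf_lt_length_iff.2 (hmem i)) hlen⟩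
    have hp : Function.Injective p := fun i j h => by
      have := (List.idxOf_inj (hmem i)).1 (congrArg Fin.val h)
      exact Fin.ext (by omega)
    let σ : Equiv.Perm (Fin n) := Equiv.ofBijective p (Finite.injective_iff_bijective.1 hp)
    refine ⟨σ, trivial, List.ext_getElem (by simp [wordOfPositions, hlen]) fun j h₁ h₂ => ?_⟩
    have hj : j < n := hlen ▸ h₂
    have h : w.idxOf ((σ.symm ⟨j, hj⟩ : ℕ) + 1) = j := congrArg Fin.val (σ.apply_symm_apply ⟨j, hj⟩)
    have h' : w[w.idxOf ((σ.symm ⟨j, hj⟩ : ℕ) + 1)]'(by omega) = (σ.symm ⟨j, hj⟩ : ℕ) + 1 :=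
      List.getElem_idxOf _
    simp only [h] at h'
    simp [wordOfPositions, h']

/-- The number of permutations of `1, …, n` such that `P` holds for the function that sends a letter
to its position. -/
noncomputable def countPositions (n : ℕ) (P : (ℕ → ℕ) → Prop) : ℕ :=
  {w | w ∈ permWords n ∧ P w.idxOf}.ncard

lemma finite_permWords (n : ℕ) : (permWords n).Finite := by
  rw [← (bijOn_wordOfPositions n).image_eq]
  exact Set.toFinite _

lemma ncard_permWords (n : ℕ) : (permWords n).ncard = n.factorial := by
  rw [← (bijOn_wordOfPositions n).image_eq,
    (bijOn_wordOfPositions n).injOn.ncard_image, Set.ncard_univ, Nat.card_perm,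
    Nat.card_fin]

/-- The permutations in which the letters `q.1` for `q` in `fs` have the positions `q.2`, and the
positions of the letters of `cs` increase along `cs`. -/
lemma countPositions_mul_factorial {n : ℕ} (fs : List (ℕ × ℕ)) (cs : List ℕ)
    (h₁ : ∀ v ∈ fs.map Prod.fst ++ cs, 1 ≤ v ∧ v ≤ n) (h₂ : (fs.map Prod.fst ++ cs).Nodup)
    (h₃ : ∀ k ∈ fs.map Prod.snd, k < n) (h₄ : (fs.map Prod.snd).Nodup) :
    countPositions n (fun p => (∀ q ∈ fs, p q.1 = q.2) ∧ (cs.map p).Pairwise (· < ·)) *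
      cs.length.factorial = (n - fs.length).factorial := by
  rw [List.nodup_append] at h₂
  obtain ⟨hd₁, hd₂, hd⟩ := h₂
  have hfs : ∀ i : Fin fs.length, 1 ≤ fs[(i : ℕ)].1 ∧ fs[(i : ℕ)].1 ≤ n := fun i =>
    h₁ _ (List.mem_append_left _ (List.mem_map_of_mem (List.getElem_mem _)))
  have hcs : ∀ i : Fin cs.length, 1 ≤ cs[(i : ℕ)] ∧ cs[(i : ℕ)] ≤ n := fun i =>
    h₁ _ (List.mem_append_right _ (List.getElem_mem _))
  let f : Fin fs.length ↪ Fin n :=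
    ⟨fun i => ⟨fs[(i : ℕ)].1 - 1, by have := hfs i; omega⟩, fun i j h => by
      have h' : fs[(i : ℕ)].1 = fs[(j : ℕ)].1 := by
        have := congrArg Fin.val h
        have := hfs i
        have := hfs j
        simp only at *
        omega
      exact Fin.ext ((hd₁.getElem_inj_iff (hi := by simp) (hj := by simp)).1 (by simpa using h'))⟩
  let g : Fin fs.length ↪ Fin n :=
    ⟨fun i => ⟨fs[(i : ℕ)].2, h₃ _ (List.mem_map_of_mem (List.getElem_mem _))⟩, fun i j h => by
      have h' : fs[(i : ℕ)].2 = fs[(j : ℕ)].2 := congrArg Fin.val h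
      exact Fin.ext ((h₄.getElem_inj_iff (hi := by simp) (hj := by simp)).1 (by simpa using h'))⟩
  let c : Fin cs.length ↪ Fin n :=
    ⟨fun i => ⟨cs[(i : ℕ)] - 1, by have := hcs i; omega⟩, fun i j h => by
      have h' : cs[(i : ℕ)] = cs[(j : ℕ)] := by
        have := congrArg Fin.val h
        have := hcs i
        have := hcs j
        simp only at *
        omega
      exact Fin.ext ((hd₂.getElem_inj_iff (hi := by simp) (hj := by simp)).1 (by simpa using h'))⟩
  have hfc : ∀ i j, f i ≠ c j := fun i j h => by
    have h' : fs[(i : ℕ)].1 - 1 = cs[(j : ℕ)] - 1 := congrArg Fin.val h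
    have h₁ := hfs i
    have h₂ := hcs j
    refine hd fs[(i : ℕ)].1 (List.mem_map_of_mem (List.getElem_mem _)) cs[(j : ℕ)]
      (List.getElem_mem _) ?_
    omega
  have hpos : ∀ (σ : Equiv.Perm (Fin n)) (v : ℕ) (h : 1 ≤ v ∧ v ≤ n),
      (wordOfPositions σ).idxOf v = σ ⟨v - 1, by omega⟩ := fun σ v h => by
    rw [← idxOf_wordOfPositions]
    congr 1
    simp only
    omega
  have hset : {w | w ∈ permWords n ∧ ((∀ q ∈ fs, w.idxOf q.1 = q.2) ∧
      (cs.map w.idxOf).Pairwise (· < ·))} =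
      wordOfPositions '' {σ : Equiv.Perm (Fin n) | (∀ i, σ (f i) = g i) ∧ StrictMono (σ ∘ c)} := by
    have key : ∀ σ : Equiv.Perm (Fin n), ((∀ i, σ (f i) = g i) ∧ StrictMono (σ ∘ c)) ↔
        ((∀ q ∈ fs, (wordOfPositions σ).idxOf q.1 = q.2) ∧
          (cs.map (wordOfPositions σ).idxOf).Pairwise (· < ·)) := fun σ => by
      refine and_congr ?_ ?_
      · rw [List.forall_mem_iff_forall_getElem]
        refine ⟨fun h i hi => ?_, fun h i => ?_⟩
        · exact (hpos σ _ (hfs ⟨i, hi⟩)).trans (congrArg Fin.val (h ⟨i, hi⟩))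
        · exact Fin.ext ((hpos σ _ (hfs i)).symm.trans (h i i.isLt))
      · rw [List.pairwise_map, List.pairwise_iff_getElem]
        refine ⟨fun h i j hi hj hij => ?_, fun h i j hij => ?_⟩
        · exact (hpos σ _ (hcs ⟨i, hi⟩)).trans_lt (lt_of_lt_of_eq
            (Fin.lt_def.1 (h (a := ⟨i, hi⟩) (b := ⟨j, hj⟩) hij)) (hpos σ _ (hcs ⟨j, hj⟩)).symm)
        · exact Fin.lt_def.2 ((hpos σ _ (hcs i)).symm.trans_lt
            (lt_of_lt_of_eq (h i j i.isLt j.isLt hij) (hpos σ _ (hcs j))))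
    ext w
    constructor
    · rintro ⟨hw, h⟩
      obtain ⟨σ, -, rfl⟩ := (bijOn_wordOfPositions n).surjOn hw
      exact ⟨σ, (key σ).2 h, rfl⟩
    · rintro ⟨σ, h, rfl⟩
      exact ⟨wordOfPositions_perm σ, (key σ).1 h⟩
  have hinj : Function.Injective (wordOfPositions (n := n)) :=
    Set.injOn_univ.1 (bijOn_wordOfPositions n).injOn
  have h := card_perm_extending_strictMono f g c hfc
  rw [Fintype.card_fin] at h
  rw [← h, countPositions, hset, Set.ncard_image_of_injective _ hinj, ← Nat.card_coe_set_eq]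
  rfl

lemma countPositions_congr {n : ℕ} (hn : 6 ≤ n) {P Q : (ℕ → ℕ) → Prop}
    (h : ∀ p : ℕ → ℕ, LetterPositions n (p n) (p (n - 1)) (p (n - 2)) (p (n - 3)) (p (n - 4)) (p 1)
      (p 2) (p 3) → (P p ↔ Q p)) :
    countPositions n P = countPositions n Q := by
  unfold countPositions
  congr 1
  ext w
  exact and_congr_right fun hw => h _ (letterPositions hn hw)

lemma countPositions_or {n : ℕ} (hn : 6 ≤ n) {P Q : (ℕ → ℕ) → Prop}
    (h : ∀ p : ℕ → ℕ, LetterPositions n (p n) (p (n - 1)) (p (n - 2)) (p (n - 3)) (p (n - 4)) (p 1)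
      (p 2) (p 3) → P p → ¬ Q p) :
    (countPositions n (fun p => P p ∨ Q p) : ℚ) = countPositions n P + countPositions n Q := by
  have hfin : ∀ P : (ℕ → ℕ) → Prop, {w | w ∈ permWords n ∧ P w.idxOf}.Finite := fun P =>
    (finite_permWords n).subset fun w hw => hw.1
  unfold countPositions
  rw [← Nat.cast_add, ← Set.ncard_union_eq _ (hfin P) (hfin Q)]
  · congr 2
    ext w
    exact and_or_left
  · exact Set.disjoint_left.2 fun w hP hQ => h _ (letterPositions hn hP.1) hP.2 hQ.2

lemma countPositions_eq {n : ℕ} {P : (ℕ → ℕ) → Prop} (fs : List (ℕ × ℕ)) (cs : List ℕ)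
    (h₁ : ∀ v ∈ fs.map Prod.fst ++ cs, 1 ≤ v ∧ v ≤ n) (h₂ : (fs.map Prod.fst ++ cs).Nodup)
    (h₃ : ∀ k ∈ fs.map Prod.snd, k < n) (h₄ : (fs.map Prod.snd).Nodup)
    (hP : ∀ p, P p ↔ (∀ q ∈ fs, p q.1 = q.2) ∧ (cs.map p).Pairwise (· < ·)) :
    (countPositions n P : ℚ) = (n - fs.length).factorial / cs.length.factorial := by
  rw [eq_div_iff (by positivity), funext fun p => propext (hP p)]
  exact_mod_cast countPositions_mul_factorial fs cs h₁ h₂ h₃ h₄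

lemma countPositions_two {n u v i j : ℕ}
    (hv : 1 ≤ u ∧ u ≤ n ∧ 1 ≤ v ∧ v ≤ n)
    (hne : u ≠ v)
    (hi : i < n ∧ j < n)
    (hine : i ≠ j) :
    (countPositions n fun p => p u = i ∧ p v = j : ℚ) =
      (n - 2).factorial := by
  rw [countPositions_eq [(u, i), (v, j)] []]
  · simp
  all_goals (simp <;> omega)

lemma countPositions_three {n u v w i j k : ℕ}
    (hv : 1 ≤ u ∧ u ≤ n ∧ 1 ≤ v ∧ v ≤ n ∧ 1 ≤ w ∧ w ≤ n)
    (hne : u ≠ v ∧ u ≠ w ∧ v ≠ w)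
    (hi : i < n ∧ j < n ∧ k < n)
    (hine : i ≠ j ∧ i ≠ k ∧ j ≠ k) :
    (countPositions n fun p => p u = i ∧ p v = j ∧ p w = k : ℚ) =
      (n - 3).factorial := by
  rw [countPositions_eq [(u, i), (v, j), (w, k)] []]
  · simp
  all_goals (simp <;> omega)

lemma countPositions_four {n u v w t i j k l : ℕ}
    (hv : 1 ≤ u ∧ u ≤ n ∧ 1 ≤ v ∧ v ≤ n ∧ 1 ≤ w ∧ w ≤ n ∧ 1 ≤ t ∧ t ≤ n)
    (hne : u ≠ v ∧ u ≠ w ∧ u ≠ t ∧ v ≠ w ∧ v ≠ t ∧ w ≠ t)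
    (hi : i < n ∧ j < n ∧ k < n ∧ l < n)
    (hine : i ≠ j ∧ i ≠ k ∧ i ≠ l ∧ j ≠ k ∧ j ≠ l ∧ k ≠ l) :
    (countPositions n fun p => p u = i ∧ p v = j ∧ p w = k ∧ p t = l : ℚ) =
      (n - 4).factorial := by
  rw [countPositions_eq [(u, i), (v, j), (w, k), (t, l)] []]
  · simp
  all_goals (simp <;> omega)

lemma countPositions_two_lt {n u v q r i j : ℕ}
    (hv : 1 ≤ u ∧ u ≤ n ∧ 1 ≤ v ∧ v ≤ n ∧ 1 ≤ q ∧ q ≤ n ∧ 1 ≤ r ∧ r ≤ n)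
    (hne : u ≠ v ∧ u ≠ q ∧ u ≠ r ∧ v ≠ q ∧ v ≠ r ∧ q ≠ r)
    (hi : i < n ∧ j < n)
    (hine : i ≠ j) :
    (countPositions n fun p => p u = i ∧ p v = j ∧ p q < p r : ℚ) =
      (n - 2).factorial / 2 := by
  rw [countPositions_eq [(u, i), (v, j)] [q, r]]
  · simp
  all_goals (simp; omega)

lemma countPositions_three_lt {n u v w q r i j k : ℕ}
    (hv : 1 ≤ u ∧ u ≤ n ∧ 1 ≤ v ∧ v ≤ n ∧ 1 ≤ w ∧ w ≤ n ∧ 1 ≤ q ∧ q ≤ n ∧ 1 ≤ r ∧ r ≤ n)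
    (hne : u ≠ v ∧ u ≠ w ∧ u ≠ q ∧ u ≠ r ∧ v ≠ w ∧ v ≠ q ∧ v ≠ r ∧ w ≠ q ∧ w ≠ r ∧ q ≠ r)
    (hi : i < n ∧ j < n ∧ k < n)
    (hine : i ≠ j ∧ i ≠ k ∧ j ≠ k) :
    (countPositions n fun p => p u = i ∧ p v = j ∧ p w = k ∧ p q < p r : ℚ) =
      (n - 3).factorial / 2 := by
  rw [countPositions_eq [(u, i), (v, j), (w, k)] [q, r]]
  · simp
  all_goals (simp; omega)

lemma countPositions_two_lt_lt {n u v q r s i j : ℕ}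
    (hv : 1 ≤ u ∧ u ≤ n ∧ 1 ≤ v ∧ v ≤ n ∧ 1 ≤ q ∧ q ≤ n ∧ 1 ≤ r ∧ r ≤ n ∧ 1 ≤ s ∧ s ≤ n)
    (hne : u ≠ v ∧ u ≠ q ∧ u ≠ r ∧ u ≠ s ∧ v ≠ q ∧ v ≠ r ∧ v ≠ s ∧ q ≠ r ∧ q ≠ s ∧ r ≠ s)
    (hi : i < n ∧ j < n)
    (hine : i ≠ j) :
    (countPositions n fun p => p u = i ∧ p v = j ∧ p q < p r ∧ p r < p s : ℚ) =
      (n - 2).factorial / 6 := by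
  rw [countPositions_eq [(u, i), (v, j)] [q, r, s]]
  · simp [Nat.factorial]
  all_goals (simp; omega)

lemma countPositions_two_lt_lt_lt {n u v q r s o i j : ℕ}
    (hv : 1 ≤ u ∧ u ≤ n ∧ 1 ≤ v ∧ v ≤ n ∧ 1 ≤ q ∧ q ≤ n ∧ 1 ≤ r ∧ r ≤ n ∧ 1 ≤ s ∧ s ≤ n ∧
      1 ≤ o ∧ o ≤ n)
    (hne : u ≠ v ∧ u ≠ q ∧ u ≠ r ∧ u ≠ s ∧ u ≠ o ∧ v ≠ q ∧ v ≠ r ∧ v ≠ s ∧ v ≠ o ∧ q ≠ r ∧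
      q ≠ s ∧ q ≠ o ∧ r ≠ s ∧ r ≠ o ∧ s ≠ o)
    (hi : i < n ∧ j < n)
    (hine : i ≠ j) :
    (countPositions n fun p => p u = i ∧ p v = j ∧ p q < p r ∧ p r < p s ∧ p s < p o : ℚ) =
      (n - 2).factorial / 24 := by
  rw [countPositions_eq [(u, i), (v, j)] [q, r, s, o]]
  · simp [Nat.factorial]
  all_goals (simp; omega)

/-! ### Counting the unsorted permutations -/

lemma countPositions_of_iff_or {n : ℕ} (hn : 6 ≤ n) {P Q R : (ℕ → ℕ) → Prop}
    (h : ∀ p : ℕ → ℕ, LetterPositions n (p n) (p (n - 1)) (p (n - 2)) (p (n - 3)) (p (n - 4)) (p 1)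
      (p 2) (p 3) → (P p ↔ R p ∨ Q p) ∧ ¬ (R p ∧ Q p)) :
    (countPositions n R : ℚ) = countPositions n P - countPositions n Q := by
  rw [countPositions_congr hn fun p hp => (h p hp).1,
    countPositions_or hn fun p hp hR hQ => (h p hp).2 ⟨hR, hQ⟩, add_sub_cancel_right]

set_option maxHeartbeats 4000000 in
/-- The cases are counted one by one. A case with a condition `≠` is what remains of a simpler case
once the configurations with `=` are removed. -/
lemma countPositions_badPositions {n : ℕ} (hn : 6 ≤ n) :
    (countPositions n fun p => BadPositions n (p n) (p (n - 1)) (p (n - 2)) (p (n - 3)) (p (n - 4))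
      (p 1) (p 2) (p 3) : ℚ) = (n - 4).factorial * (37 * n ^ 2 - 176 * n + 192) / 3 := by
  have c₁ : (countPositions n fun p =>
      p n = n - 2 ∧ p (n - 1) = n - 4 ∧ p 1 = n - 3 ∧ p 2 ≠ n - 1 ∧ p 3 ≠ n - 1 : ℚ) =
      (n - 3).factorial - ((n - 4).factorial + (n - 4).factorial) := by
    rw [countPositions_of_iff_or hn (P := fun p => p n = n - 2 ∧ p (n - 1) = n - 4 ∧ p 1 = n - 3)
      (Q := fun p => (p n = n - 2 ∧ p (n - 1) = n - 4 ∧ p 1 = n - 3 ∧ p 2 = n - 1) ∨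
      (p n = n - 2 ∧ p (n - 1) = n - 4 ∧ p 1 = n - 3 ∧ p 3 = n - 1))
      fun p h => by
        generalize p n = a, p (n - 1) = b, p (n - 2) = c, p (n - 3) = d, p (n - 4) = e, p 1 = x,
          p 2 = y, p 3 = z at *
        obtain ⟨la, lb, lc, ld, le, lx, ly, lz, ab, ac, ad, ae, bc, bd, be, cd, ce, de, ax, bx, cx,
          dx, ex, ay, yb, cy, az, bz, cz, xy, xz, yz⟩ := h
        grind]
    rw [countPositions_or hn fun p h h₁ h₂ => h.yz (h₁.2.2.2.trans h₂.2.2.2.symm)]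
    simp (disch := omega) only [countPositions_three, countPositions_four]
  have c₂ : (countPositions n fun p => p n = n - 3 ∧ p 2 = n - 2 ∧ p 1 ≠ n - 1 : ℚ) =
      (n - 2).factorial - (n - 3).factorial := by
    rw [countPositions_of_iff_or hn (P := fun p => p n = n - 3 ∧ p 2 = n - 2)
      (Q := fun p => p n = n - 3 ∧ p 2 = n - 2 ∧ p 1 = n - 1)
      fun p h => by
        generalize p n = a, p (n - 1) = b, p (n - 2) = c, p (n - 3) = d, p (n - 4) = e, p 1 = x,
          p 2 = y, p 3 = z at *
        obtain ⟨la, lb, lc, ld, le, lx, ly, lz, ab, ac, ad, ae, bc, bd, be, cd, ce, de, ax, bx, cx,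
          dx, ex, ay, yb, cy, az, bz, cz, xy, xz, yz⟩ := h
        grind]
    simp (disch := omega) only [countPositions_two, countPositions_three]
  have c₃ : (countPositions n fun p => p n = n - 3 ∧ p 2 = n - 1 ∧ p 1 ≠ n - 2 : ℚ) =
      (n - 2).factorial - (n - 3).factorial := by
    rw [countPositions_of_iff_or hn (P := fun p => p n = n - 3 ∧ p 2 = n - 1)
      (Q := fun p => p n = n - 3 ∧ p 2 = n - 1 ∧ p 1 = n - 2)
      fun p h => by
        generalize p n = a, p (n - 1) = b, p (n - 2) = c, p (n - 3) = d, p (n - 4) = e, p 1 = x,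
          p 2 = y, p 3 = z at *
        obtain ⟨la, lb, lc, ld, le, lx, ly, lz, ab, ac, ad, ae, bc, bd, be, cd, ce, de, ax, bx, cx,
          dx, ex, ay, yb, cy, az, bz, cz, xy, xz, yz⟩ := h
        grind]
    simp (disch := omega) only [countPositions_two, countPositions_three]
  have c₄ : (countPositions n fun p =>
      p n = n - 4 ∧ p 1 = n - 1 ∧ ¬ (p (n - 2) = n - 3 ∧ p (n - 1) = n - 2) : ℚ) =
      (n - 2).factorial - (n - 4).factorial := by
    rw [countPositions_of_iff_or hn (P := fun p => p n = n - 4 ∧ p 1 = n - 1)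
      (Q := fun p => p n = n - 4 ∧ p 1 = n - 1 ∧ p (n - 2) = n - 3 ∧ p (n - 1) = n - 2)
      fun p h => by
        generalize p n = a, p (n - 1) = b, p (n - 2) = c, p (n - 3) = d, p (n - 4) = e, p 1 = x,
          p 2 = y, p 3 = z at *
        obtain ⟨la, lb, lc, ld, le, lx, ly, lz, ab, ac, ad, ae, bc, bd, be, cd, ce, de, ax, bx, cx,
          dx, ex, ay, yb, cy, az, bz, cz, xy, xz, yz⟩ := h
        grind]
    simp (disch := omega) only [countPositions_two, countPositions_four]
  have c₅ : (countPositions n fun p =>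
      p (n - 1) = n - 3 ∧ p 1 = n - 2 ∧ p n < p (n - 2) ∧ p (n - 2) ≠ n - 1 : ℚ) =
      (n - 2).factorial / 2 - (n - 3).factorial := by
    rw [countPositions_of_iff_or hn
      (P := fun p => p (n - 1) = n - 3 ∧ p 1 = n - 2 ∧ p n < p (n - 2))
      (Q := fun p => p (n - 1) = n - 3 ∧ p 1 = n - 2 ∧ p (n - 2) = n - 1)
      fun p h => by
        generalize p n = a, p (n - 1) = b, p (n - 2) = c, p (n - 3) = d, p (n - 4) = e, p 1 = x,
          p 2 = y, p 3 = z at *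
        obtain ⟨la, lb, lc, ld, le, lx, ly, lz, ab, ac, ad, ae, bc, bd, be, cd, ce, de, ax, bx, cx,
          dx, ex, ay, yb, cy, az, bz, cz, xy, xz, yz⟩ := h
        grind]
    simp (disch := omega) only [countPositions_three, countPositions_two_lt]
  have c₆ : (countPositions n fun p =>
      p (n - 1) = n - 3 ∧ p 1 = n - 1 ∧ p n < p (n - 2) ∧ p (n - 2) ≠ n - 2 : ℚ) =
      (n - 2).factorial / 2 - (n - 3).factorial := by
    rw [countPositions_of_iff_or hn
      (P := fun p => p (n - 1) = n - 3 ∧ p 1 = n - 1 ∧ p n < p (n - 2))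
      (Q := fun p => p (n - 1) = n - 3 ∧ p 1 = n - 1 ∧ p (n - 2) = n - 2)
      fun p h => by
        generalize p n = a, p (n - 1) = b, p (n - 2) = c, p (n - 3) = d, p (n - 4) = e, p 1 = x,
          p 2 = y, p 3 = z at *
        obtain ⟨la, lb, lc, ld, le, lx, ly, lz, ab, ac, ad, ae, bc, bd, be, cd, ce, de, ax, bx, cx,
          dx, ex, ay, yb, cy, az, bz, cz, xy, xz, yz⟩ := h
        grind]
    simp (disch := omega) only [countPositions_three, countPositions_two_lt]
  have h₃ : ((n - 3).factorial : ℚ) = (n - 3) * (n - 4).factorial := by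
    rw [show n - 3 = n - 4 + 1 by omega, Nat.factorial_succ]
    push_cast [Nat.cast_sub (show 4 ≤ n by omega)]
    ring
  have h₂ : ((n - 2).factorial : ℚ) = (n - 2) * (n - 3) * (n - 4).factorial := by
    rw [show n - 2 = n - 3 + 1 by omega, Nat.factorial_succ, Nat.cast_mul, h₃]
    push_cast [Nat.cast_sub (show 3 ≤ n by omega)]
    ring
  -- distribute, so that the cases form a single disjunction
  simp only [BadPositions, and_or_left, or_assoc]
  repeat rw [countPositions_or hn]
  · simp (disch := omega) only [c₁, c₂, c₃, c₄, c₅, c₆, countPositions_two, countPositions_three,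
      countPositions_four, countPositions_two_lt, countPositions_three_lt, countPositions_two_lt_lt,
      countPositions_two_lt_lt_lt]
    rw [h₂, h₃]
    ring
  -- the cases are mutually exclusive
  all_goals
    intro p h hP hQ
    generalize p n = a, p (n - 1) = b, p (n - 2) = c, p (n - 3) = d, p (n - 4) = e, p 1 = x,
      p 2 = y, p 3 = z at *
    obtain ⟨la, lb, lc, ld, le, lx, ly, lz, ab, ac, ad, ae, bc, bd, be, cd, ce, de, ax, bx, cx, dx,
      ex, ay, yb, cy, az, bz, cz, xy, xz, yz⟩ := h
    grind (splits := 40)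

theorem mainTheorem2 (n : ℕ) (hn : 6 ≤ n) :
    stackSortable n (n - 4) = permWords n \ (typesA n ∪ typesB n ∪ typesC n) ∧
    ((stackSortable n (n - 4)).ncard : ℚ) =
      (Nat.factorial (n - 4) : ℚ) *
        (3 * (n : ℚ) ^ 4 - 18 * (n : ℚ) ^ 3 - 4 * (n : ℚ) ^ 2 + 158 * (n : ℚ) - 192) / 3 := by
  constructor
  · ext w
    refine and_congr_right fun hw => ?_
    rw [mem_types_iff_badPositions hn hw, ← not_sorted_iff_badPositions hn hw, not_not]
  · set B : Set (List ℕ) := {w | w ∈ permWords n ∧ BadPositions n (w.idxOf n) (w.idxOf (n - 1))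
      (w.idxOf (n - 2)) (w.idxOf (n - 3)) (w.idxOf (n - 4)) (w.idxOf 1) (w.idxOf 2) (w.idxOf 3)}
    have hB : stackSortable n (n - 4) = permWords n \ B := by
      ext w
      refine and_congr_right fun hw => ?_
      rw [← not_iff_not, not_not]
      exact (not_sorted_iff_badPositions hn hw).trans ⟨fun h => ⟨hw, h⟩, fun h => h.2⟩
    have hBn : (B.ncard : ℚ) = (n - 4).factorial * (37 * n ^ 2 - 176 * n + 192) / 3 :=
      countPositions_badPositions hn
    have hfac : (n.factorial : ℚ) = n * (n - 1) * (n - 2) * (n - 3) * (n - 4).factorial := by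
      obtain ⟨k, rfl⟩ : ∃ k, n = k + 4 := ⟨n - 4, by omega⟩
      simp only [Nat.add_sub_cancel, Nat.factorial_succ]
      push_cast
      ring
    have hsub : B ⊆ permWords n := fun w hw => hw.1
    have hadd := Set.ncard_sdiff_add_ncard_of_subset hsub (finite_permWords n)
    have hadd' : ((permWords n \ B).ncard : ℚ) + B.ncard = n.factorial := by
      rw [← ncard_permWords n]
      exact_mod_cast hadd
    rw [hB, eq_sub_of_add_eq hadd', hBn, hfac]
    ring
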